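/- Let $n>1$. An oriented simple $n$-polytope $P\subset\mathbb{R}^n$ with facets $F_1,\dots,F_m$, considered up to oriented combinatorial equivalence, together with an integral $(n\times m)$-matrix $\Lambda$ with columns $\lambda_1,\dots,\lambda_m\in\mathbb{Z}^n$, is called a quasitoric pair if $\det(\lambda_{i_1}\cdots\lambda_{i_n})=\pm1$ whenever $F_{i_1}\cap\dots\cap F_{i_n}$ is a vertex of $P$. Let $J_n^*=\mathbb{Z}^n\smallsetminus\{0\}$ and let $\Lambda^n(J_n^*)$ be the $n$-th exterior power of the free exterior algebra over $\mathbb{Z}$ on the set $J_n^*$ (that is, of the exterior algebra of the free abelian group with basis $J_n^*$). The quasitoric polynomial of $(P,\Lambda)$ is $$\mathfrak{g}(P,\Lambda)=\sum_{v}\lambda_{v_1}\wedge\dots\wedge\lambda_{v_n}\in\Lambda^n(J_n^*),$$ where $v$ runs over the vertices of $P$ and $F_{v_1},\dots,F_{v_n}$ are the facets that contain $v$, ordered so that their inward pointing normals form a positive basis for the orientation of $P$. Proposition. If $h_1$ and $h_2$ are the quasitoric polynomials of quasitoric pairs $(P_1,\Lambda_1)$ and $(P_2,\Lambda_2)$ with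 $P_1,P_2$ of dimension $n>1$, then $h_1+h_2\in\Lambda^n(J_n^*)$ is the quasitoric polynomial of a quasitoric pair $(P,\Lambda)$ with $P$ of dimension $n$. -/

import Mathlib

noncomputable section

namespace Quasitoric

open scoped Classical

/-- An oriented simple `n`-polytope, presented as a bounded intersection of `numFacets` irredundant
half-spaces `{x | offset i ≤ ⟨normal i, x⟩}` of `ℝⁿ`, with nonempty interior. A combinatorial
polytope is represented by any of its realizations. The orientation is `1` if it
is the one inherited from the standard orientation of `ℝⁿ` and `-1` if it is the opposite one. -/
structure OrientedSimplePolytope (n : ℕ) where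
  numFacets : ℕ
  /-- the inward pointing normals of the facets -/
  normal : Fin numFacets → Fin n → ℝ
  offset : Fin numFacets → ℝ
  orientation : ℤˣ
  normal_ne_zero : ∀ i, normal i ≠ 0
  bounded : Bornology.IsBounded {x : Fin n → ℝ | ∀ i, offset i ≤ normal i ⬝ᵥ x}
  full_dim : (interior {x : Fin n → ℝ | ∀ i, offset i ≤ normal i ⬝ᵥ x}).Nonempty
  /-- no half-space may be omitted -/
  irredundant : ∀ i, ∃ x : Fin n → ℝ,
    (∀ j, j ≠ i → offset j ≤ normal j ⬝ᵥ x) ∧ normal i ⬝ᵥ x < offset i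
  /-- every vertex lies on exactly `n` facets -/
  simple : ∀ v ∈ Set.extremePoints ℝ {x : Fin n → ℝ | ∀ i, offset i ≤ normal i ⬝ᵥ x},
    (Finset.univ.filter fun i => normal i ⬝ᵥ v = offset i).card = n

namespace OrientedSimplePolytope

variable {n : ℕ} (P : OrientedSimplePolytope n)

/-- The polytope as a subset of `ℝⁿ`. -/
def carrier : Set (Fin n → ℝ) := {x | ∀ i, P.offset i ≤ P.normal i ⬝ᵥ x}

/-- The `i`-th facet. -/
def facet (i : Fin P.numFacets) : Set (Fin n → ℝ) :=
  {x | x ∈ P.carrier ∧ P.normal i ⬝ᵥ x = P.offset i}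

/-- The vertices. -/
def vertices : Set (Fin n → ℝ) := Set.extremePoints ℝ P.carrier

/-- The (indices of the) facets that contain a given point of the polytope. -/
def facetsAt (v : Fin n → ℝ) : Finset (Fin P.numFacets) :=
  Finset.univ.filter fun i => P.normal i ⬝ᵥ v = P.offset i

theorem mem_facetsAt_iff {v : Fin n → ℝ} (hv : v ∈ P.carrier) (i : Fin P.numFacets) :
    i ∈ P.facetsAt v ↔ v ∈ P.facet i := by
  simp [facetsAt, facet, hv]

theorem card_facetsAt {v : Fin n → ℝ} (hv : v ∈ P.vertices) : (P.facetsAt v).card = n :=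
  P.simple v hv

/-- A direction parallel to all facets at a vertex is zero. -/
theorem eq_zero_of_parallel {v : Fin n → ℝ} (hv : v ∈ P.vertices) {d : Fin n → ℝ}
    (hd : ∀ i ∈ P.facetsAt v, P.normal i ⬝ᵥ d = 0) : d = 0 := by
  have hvP : v ∈ P.carrier := hv.1
  have key : ∀ i, ∀ᶠ t : ℝ in nhds 0,
      P.offset i ≤ P.normal i ⬝ᵥ (v + t • d) ∧ P.offset i ≤ P.normal i ⬝ᵥ (v - t • d) := by
    intro i
    by_cases hi : i ∈ P.facetsAt v
    · have h0 := hd i hi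
      filter_upwards with t
      simp only [dotProduct_add, dotProduct_sub, dotProduct_smul, h0, smul_zero, add_zero,
        sub_zero, and_self]
      exact hvP i
    · have hlt : P.offset i < P.normal i ⬝ᵥ v := by
        refine lt_of_le_of_ne (hvP i) fun h => hi ?_
        simp [facetsAt, h.symm]
      have c1 : Continuous fun t : ℝ => P.normal i ⬝ᵥ v + t * (P.normal i ⬝ᵥ d) := by fun_prop
      have c2 : Continuous fun t : ℝ => P.normal i ⬝ᵥ v - t * (P.normal i ⬝ᵥ d) := by fun_prop
      have e1 := (c1.tendsto 0).eventually (lt_mem_nhds (a := P.offset i) (by simpa using hlt))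
      have e2 := (c2.tendsto 0).eventually (lt_mem_nhds (a := P.offset i) (by simpa using hlt))
      filter_upwards [e1, e2] with t h1 h2
      simp only [dotProduct_add, dotProduct_sub, dotProduct_smul, smul_eq_mul]
      exact ⟨h1.le, h2.le⟩
  have hall := Filter.eventually_all.2 key
  obtain ⟨ε, hε, hb⟩ := Metric.eventually_nhds_iff.1 hall
  have hlt : dist (ε / 2) 0 < ε := by
    rw [Real.dist_0_eq_abs, abs_of_pos (by positivity)]; linarith
  have hb' := hb hlt
  have h1 : v + (ε / 2) • d ∈ P.carrier := fun i => (hb' i).1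
  have h2 : v - (ε / 2) • d ∈ P.carrier := fun i => (hb' i).2
  have hseg : v ∈ openSegment ℝ (v + (ε / 2) • d) (v - (ε / 2) • d) := by
    refine ⟨1 / 2, 1 / 2, by norm_num, by norm_num, by norm_num, ?_⟩
    rw [← smul_add, add_add_sub_cancel, ← two_smul ℝ v, smul_smul]
    norm_num
  have h3 := hv.2 h1 h2 hseg
  have h4 : (ε / 2) • d = 0 := by simpa using h3
  rcases smul_eq_zero.1 h4 with h | h
  · linarith
  · exact h

theorem vertices_finite : P.vertices.Finite := by
  refine Set.Finite.of_finite_image (f := P.facetsAt) (Set.toFinite _) ?_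
  intro v hv w hw hvw
  have : w - v = 0 := P.eq_zero_of_parallel hv fun i hi => by
    have hi' : i ∈ P.facetsAt w := by rw [← hvw]; exact hi
    have h1 : P.normal i ⬝ᵥ v = P.offset i := by simpa [facetsAt] using hi
    have h2 : P.normal i ⬝ᵥ w = P.offset i := by simpa [facetsAt] using hi'
    rw [dotProduct_sub, h1, h2, sub_self]
  exact (sub_eq_zero.1 this).symm

/-- The facets at a vertex, in increasing order of their indices. -/
def ordering (v : P.vertices) : Fin n → Fin P.numFacets :=
  (P.facetsAt v).orderEmbOfFin (P.card_facetsAt v.2)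

/-- The sign of a tuple of facets: `1` if their inward pointing normals form a positive
basis for the orientation of `P`, `-1` if they form a negative basis, `0` if they form no basis. -/
def orderingSign (i : Fin n → Fin P.numFacets) : ℤ :=
  (P.orientation : ℤ) * (SignType.sign (Matrix.det fun a b => P.normal (i a) b) : ℤ)

/-- `i` lists the `n` facets at `v`, ordered so that their inward pointing normals form a
positive basis for the orientation of `P`. -/
def IsPositiveOrdering (v : Fin n → ℝ) (i : Fin n → Fin P.numFacets) : Prop :=
  Function.Injective i ∧ (∀ a, v ∈ P.facet (i a)) ∧ P.orderingSign i = 1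

/-- For `n > 1` the facets at each vertex have a positive ordering. -/
theorem exists_isPositiveOrdering (hn : 1 < n) (v : P.vertices) :
    ∃ i, P.IsPositiveOrdering v i := by
  set o := P.ordering v with ho
  have hoinj : Function.Injective o :=
    ((P.facetsAt v).orderEmbOfFin (P.card_facetsAt v.2)).injective
  have hrange : Set.range o = (P.facetsAt v : Set _) :=
    Finset.range_orderEmbOfFin _ (P.card_facetsAt v.2)
  have homem : ∀ a, v.1 ∈ P.facet (o a) := fun a =>
    (P.mem_facetsAt_iff v.2.1 _).1 (by
      have : o a ∈ (P.facetsAt v : Set _) := hrange ▸ Set.mem_range_self a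
      exact this)
  have hdet : Matrix.det (fun a b => P.normal (o a) b) ≠ 0 := by
    intro h0
    obtain ⟨d, hd0, hd⟩ := Matrix.exists_mulVec_eq_zero_iff.2 h0
    refine hd0 (P.eq_zero_of_parallel v.2 fun i hi => ?_)
    have hi' : i ∈ Set.range o := by rw [hrange]; exact hi
    obtain ⟨a, rfl⟩ := hi'
    exact congrFun hd a
  have hso : P.orderingSign o = 1 ∨ P.orderingSign o = -1 := by
    unfold orderingSign
    rcases lt_or_gt_of_ne hdet with h | h <;>
      rcases Int.units_eq_one_or P.orientation with h' | h' <;>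
      simp [h', sign_neg, sign_pos, h]
  rcases hso with h | h
  · exact ⟨o, hoinj, homem, h⟩
  · let σ : Equiv.Perm (Fin n) := Equiv.swap ⟨0, by omega⟩ ⟨1, hn⟩
    refine ⟨fun a => o (σ a), hoinj.comp σ.injective, fun a => homem _, ?_⟩
    have hs : (Equiv.Perm.sign σ : ℤ) = -1 := by
      rw [Equiv.Perm.sign_swap (by simp)]; rfl
    have hp : Matrix.det (fun a b => P.normal (o (σ a)) b) =
        (Equiv.Perm.sign σ : ℤ) * Matrix.det (fun a b => P.normal (o a) b) :=
      Matrix.det_permute σ (fun a b => P.normal (o a) b)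
    unfold orderingSign at h ⊢
    rw [hp, hs]
    simp only [Int.cast_neg, Int.cast_one, neg_mul, one_mul, Left.sign_neg, SignType.coe_neg,
      mul_neg, h, neg_neg]

end OrientedSimplePolytope

/-- The nontrivial elements of `Hom(S¹, Tⁿ) ≅ ℤⁿ`. -/
abbrev J (n : ℕ) : Type := {s : Fin n → ℤ // s ≠ 0}

/-- The `k`-th exterior power `Λᵏ(S)` of the free exterior algebra over `ℤ` on the set `S`, which
is the exterior algebra of the free module on `S`. -/
abbrev FreeExteriorPower (k : ℕ) (S : Type) : Type := ⋀[ℤ]^k (S →₀ ℤ)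

/-- The monomial `s₁ ∧ ⋯ ∧ sₖ` in indeterminates from `S`. -/
def wedge {k : ℕ} {S : Type} (s : Fin k → S) : FreeExteriorPower k S :=
  exteriorPower.ιMulti ℤ k fun a => Finsupp.single (s a) 1

/-- A quasitoric pair `(P, Λ)`; the `i`-th column of the integral matrix `Λ` is `col i`. -/
structure QuasitoricPair (n : ℕ) where
  P : OrientedSimplePolytope n
  col : Fin P.numFacets → J n
  /-- `det (λ_{i₁} ⋯ λ_{iₙ}) = ±1` whenever `F_{i₁}, …, F_{iₙ}` are the facets at a vertex -/
  star : ∀ v ∈ P.vertices, ∀ i : Fin n → Fin P.numFacets, Function.Injective i →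
    (∀ a, v ∈ P.facet (i a)) →
      Matrix.det (Matrix.of fun b a => (col (i a)).1 b) = 1 ∨
      Matrix.det (Matrix.of fun b a => (col (i a)).1 b) = -1

namespace QuasitoricPair

variable {n : ℕ} (X : QuasitoricPair n)

/-- The monomial at a vertex: the wedge of the labels of the facets at `v`, taken in
a positive order (see `monomial_eq`). It is computed from the increasing order of the facets,
corrected by the sign of that order. -/
def monomial (v : X.P.vertices) : FreeExteriorPower n (J n) :=
  X.P.orderingSign (X.P.ordering v) • wedge fun a => X.col (X.P.ordering v a)

/-- The quasitoric polynomial: the sum over the vertices of the monomials at the vertices. -/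
def polynomial : FreeExteriorPower n (J n) :=
  letI : Fintype X.P.vertices := X.P.vertices_finite.fintype
  ∑ v : X.P.vertices, X.monomial v

/-- The monomial at `v` is the wedge of the labels in any positive order of the facets at `v`. -/
theorem monomial_eq (v : X.P.vertices) (i : Fin n → Fin X.P.numFacets)
    (hi : X.P.IsPositiveOrdering v i) : X.monomial v = wedge fun a => X.col (i a) := by
  obtain ⟨hinj, hmem, hsign⟩ := hi
  set o := X.P.ordering v with ho
  have hoinj : Function.Injective o :=
    ((X.P.facetsAt v).orderEmbOfFin (X.P.card_facetsAt v.2)).injective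
  have hrange : ∀ a, ∃ b, o b = i a := by
    intro a
    have h1 : i a ∈ X.P.facetsAt v := (X.P.mem_facetsAt_iff v.2.1 _).2 (hmem a)
    have h2 : Set.range o = (X.P.facetsAt v : Set _) :=
      Finset.range_orderEmbOfFin _ (X.P.card_facetsAt v.2)
    have h3 : i a ∈ Set.range o := by rw [h2]; exact h1
    exact h3
  choose f hf using hrange
  have hfinj : Function.Injective f := fun a b hab => hinj (by rw [← hf a, ← hf b, hab])
  let σ : Equiv.Perm (Fin n) := Equiv.ofBijective f (Finite.injective_iff_bijective.1 hfinj)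
  have hio : i = fun a => o (σ a) := funext fun a => (hf a).symm
  have hdet : Matrix.det (fun a b => X.P.normal (i a) b) =
      (Equiv.Perm.sign σ : ℤ) * Matrix.det (fun a b => X.P.normal (o a) b) := by
    rw [hio]
    exact Matrix.det_permute σ (fun a b => X.P.normal (o a) b)
  have hs : X.P.orderingSign i = (Equiv.Perm.sign σ : ℤ) * X.P.orderingSign o := by
    unfold OrientedSimplePolytope.orderingSign
    rw [hdet]
    rcases Int.units_eq_one_or (Equiv.Perm.sign σ) with h | h <;> simp [h, Left.sign_neg]
  have hw : (wedge fun a => X.col (i a)) =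
      (Equiv.Perm.sign σ) • wedge fun a => X.col (o a) := by
    rw [hio]
    exact AlternatingMap.map_perm (exteriorPower.ιMulti ℤ n)
      (fun a => Finsupp.single (X.col (o a)) (1 : ℤ)) σ
  unfold monomial
  rw [← ho, hw]
  rw [hsign] at hs
  rcases Int.units_eq_one_or (Equiv.Perm.sign σ) with h | h
  · rw [h] at hs ⊢
    have : X.P.orderingSign o = 1 := by simpa using hs.symm
    simp [this]
  · rw [h] at hs ⊢
    have : X.P.orderingSign o = -1 := by
      simp only [Units.val_neg, Units.val_one] at hs
      linarith
    simp [this]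

end QuasitoricPair

/-- `h` is the quasitoric polynomial of some quasitoric pair of dimension `n`. -/
def IsQuasitoricPolynomial {n : ℕ} (h : FreeExteriorPower n (J n)) : Prop :=
  ∃ X : QuasitoricPair n, X.polynomial = h

end Quasitoric

end

noncomputable section

namespace Quasitoric

open scoped Classical
open Matrix

/-! The proof is an equivariant connected sum at vertices, carried out with explicit inequalities.
Move a vertex of each polytope to the origin so that its facets become coordinate hyperplanes. The
projective involution `y ↦ y / (M ∑ y - 1)` preserves these hyperplanes and, for large `M`, carries
the nonzero vertices of the second polytope close to the origin. The images of its remaining facets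
cut the origin off the first polytope, and the vertices of the result are exactly the nonzero
vertices of both. If the two corners at the origin have equal labels and opposite signs, their
monomials cancel, so the polynomial of the result is the sum of the two polynomials
(`exists_connectedSum`).

It remains to give one polytope a corner with prescribed unimodular labels and sign without changing
its polynomial (`HasCorner.change`). A single label, in position `j`, is replaced by a connected sum
with a cube whose opposite facets have equal labels in every direction except possibly `j`
(`HasCorner.update`). As `n > 1`, there is a direction with equal labels; crossing the cube in that
direction pairs vertices with opposite monomials, so the cube contributes zero
(`polynomial_cube_eq_zero`). Its vertices with `x j = 1` survive, carry the new labels, and occur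
with both signs. Finally, the Euclidean algorithm connects any two unimodular integral matrices by
changes of single rows that stay unimodular (`reflTransGen_rowStep`). -/

/-- Finitely many half-spaces `{x | offset i ≤ ⟨normal i, x⟩}` of `ℝⁿ` with labels and
an orientation. -/
structure LabelledArrangement (n : ℕ) (ι : Type) where
  normal : ι → Fin n → ℝ
  offset : ι → ℝ
  orientation : ℤˣ
  label : ι → J n

/-! ### Vertices, corners and monomials of an arrangement -/

namespace LabelledArrangement

variable {n : ℕ} {ι : Type} (L : LabelledArrangement n ι)

/-- The intersection of the half-spaces. -/
def carrier : Set (Fin n → ℝ) := {x | ∀ i, L.offset i ≤ L.normal i ⬝ᵥ x}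

/-- The matrix whose rows are the normals of a tuple of half-spaces. -/
def normals (i : Fin n → ι) : Matrix (Fin n) (Fin n) ℝ := Matrix.of fun a b => L.normal (i a) b

/-- The matrix whose rows are the labels of a tuple of half-spaces. -/
def labels (i : Fin n → ι) : Matrix (Fin n) (Fin n) ℤ :=
  Matrix.of fun a b => (L.label (i a)).1 b

/-- `x` is a point of the intersection at which the normals of the active constraints span. -/
def IsVertex (x : Fin n → ℝ) : Prop :=
  x ∈ L.carrier ∧ ∀ d : Fin n → ℝ,
    (∀ k, L.normal k ⬝ᵥ x = L.offset k → L.normal k ⬝ᵥ d = 0) → d = 0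

/-- The tuple `i` lists the constraints active at the point `x` of the intersection, and their
normals form a basis. -/
structure IsCorner (x : Fin n → ℝ) (i : Fin n → ι) : Prop where
  mem : x ∈ L.carrier
  active : ∀ k, L.normal k ⬝ᵥ x = L.offset k ↔ k ∈ Set.range i
  det_ne : (L.normals i).det ≠ 0

/-- The signed monomial of a tuple of half-spaces. -/
def term (i : Fin n → ι) : FreeExteriorPower n (J n) :=
  ((L.orientation : ℤ) * (SignType.sign (L.normals i).det : ℤ)) • wedge fun a => L.label (i a)

/-- The signed monomial at a simple vertex. -/
def monomial (x : Fin n → ℝ) : FreeExteriorPower n (J n) :=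
  -- The choice of `i` is immaterial by `IsCorner.monomial_eq`, and under `IsQuasitoric` every
  -- vertex is a corner, so the default 0 does not enter `polynomial`.
  if h : ∃ i, L.IsCorner x i then L.term h.choose else 0

/-- The sum of the signed monomials at the vertices. -/
def polynomial : FreeExteriorPower n (J n) := ∑ᶠ x ∈ {x | L.IsVertex x}, L.monomial x

/-- The half-spaces cut out a simple polytope, none of them is superfluous, and the labels
at each vertex form a basis of `ℤⁿ`. -/
structure IsQuasitoric : Prop where
  bounded : Bornology.IsBounded L.carrier
  interior : ∃ x, ∀ i, L.offset i < L.normal i ⬝ᵥ x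
  corner : ∀ x, L.IsVertex x → ∃ i, L.IsCorner x i ∧ IsUnit (L.labels i).det
  used : ∀ k, ∃ x, L.IsVertex x ∧ L.normal k ⬝ᵥ x = L.offset k

variable {L}

theorem normals_mulVec (i : Fin n → ι) (x : Fin n → ℝ) (a : Fin n) :
    (L.normals i *ᵥ x) a = L.normal (i a) ⬝ᵥ x := rfl

theorem IsCorner.injective {x : Fin n → ℝ} {i : Fin n → ι} (h : L.IsCorner x i) :
    Function.Injective i := by
  intro a b hab
  by_contra hne
  exact h.det_ne (Matrix.det_zero_of_row_eq hne (by
    funext c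
    simp [normals, hab]))

theorem IsCorner.isVertex {x : Fin n → ℝ} {i : Fin n → ι} (h : L.IsCorner x i) :
    L.IsVertex x := by
  refine ⟨h.mem, fun d hd => ?_⟩
  by_contra hne
  refine h.det_ne (Matrix.exists_mulVec_eq_zero_iff.1 ⟨d, hne, funext fun a => ?_⟩)
  exact hd _ ((h.active _).2 ⟨a, rfl⟩)

theorem IsCorner.of_isVertex {x : Fin n → ℝ} {i : Fin n → ι} (h : L.IsVertex x)
    (hi : ∀ k, L.normal k ⬝ᵥ x = L.offset k ↔ k ∈ Set.range i) : L.IsCorner x i := by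
  refine ⟨h.1, hi, fun h0 => ?_⟩
  obtain ⟨d, hd0, hd⟩ := Matrix.exists_mulVec_eq_zero_iff.2 h0
  refine hd0 (h.2 d fun k hk => ?_)
  obtain ⟨a, rfl⟩ := (hi k).1 hk
  exact congrFun hd a

theorem IsCorner.exists_perm {x : Fin n → ℝ} {i j : Fin n → ι} (hi : L.IsCorner x i)
    (hj : L.IsCorner x j) : ∃ σ : Equiv.Perm (Fin n), j = fun a => i (σ a) := by
  have h : ∀ a, ∃ b, i b = j a := fun a => (hi.active _).1 ((hj.active _).2 ⟨a, rfl⟩)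
  choose f hf using h
  have hfinj : Function.Injective f := fun a b hab => hj.injective (by rw [← hf a, ← hf b, hab])
  exact ⟨Equiv.ofBijective f (Finite.injective_iff_bijective.1 hfinj),
    funext fun a => (hf a).symm⟩

/-- The sign of the permutation appears once in the determinant and once in the wedge, and so
cancels. -/
theorem term_perm (i : Fin n → ι) (σ : Equiv.Perm (Fin n)) :
    L.term (fun a => i (σ a)) = L.term i := by
  have hdet : (L.normals fun a => i (σ a)).det =
      (Equiv.Perm.sign σ : ℤ) * (L.normals i).det :=
    Matrix.det_permute σ (L.normals i)
  have hw : (wedge fun a => L.label (i (σ a))) =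
      (Equiv.Perm.sign σ) • wedge fun a => L.label (i a) :=
    AlternatingMap.map_perm (exteriorPower.ιMulti ℤ n)
      (fun a => Finsupp.single (L.label (i a)) (1 : ℤ)) σ
  unfold term
  rw [hdet, hw]
  rcases Int.units_eq_one_or (Equiv.Perm.sign σ) with h | h <;> simp [h, Left.sign_neg]

theorem IsCorner.term_eq {x : Fin n → ℝ} {i j : Fin n → ι} (hi : L.IsCorner x i)
    (hj : L.IsCorner x j) : L.term i = L.term j := by
  obtain ⟨σ, rfl⟩ := hi.exists_perm hj
  exact (term_perm i σ).symm

theorem IsCorner.monomial_eq {x : Fin n → ℝ} {i : Fin n → ι} (hi : L.IsCorner x i) :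
    L.monomial x = L.term i := by
  have h : ∃ i, L.IsCorner x i := ⟨i, hi⟩
  rw [monomial, dif_pos h]
  exact h.choose_spec.term_eq hi

theorem IsQuasitoric.isUnit_labels (hL : L.IsQuasitoric) {x : Fin n → ℝ} {i : Fin n → ι}
    (hi : L.IsCorner x i) : IsUnit (L.labels i).det := by
  obtain ⟨j, hj, hu⟩ := hL.corner x hi.isVertex
  obtain ⟨σ, rfl⟩ := hj.exists_perm hi
  have hdet : (L.labels fun a => j (σ a)).det = (Equiv.Perm.sign σ : ℤ) * (L.labels j).det :=
    Matrix.det_permute σ (L.labels j)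
  rw [hdet]
  exact (Equiv.Perm.sign σ).isUnit.mul hu

theorem isClosed_carrier : IsClosed L.carrier := by
  have : L.carrier = ⋂ i, {x | L.offset i ≤ L.normal i ⬝ᵥ x} := by
    ext; simp [carrier]
  rw [this]
  exact isClosed_iInter fun i => isClosed_le continuous_const (by fun_prop)

theorem IsQuasitoric.isCompact (hL : L.IsQuasitoric) : IsCompact L.carrier :=
  Metric.isCompact_of_isClosed_isBounded isClosed_carrier hL.bounded

theorem convex_carrier : Convex ℝ L.carrier := by
  intro x hx y hy a b ha hb hab i
  have h1 := mul_le_mul_of_nonneg_left (hx i) ha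
  have h2 := mul_le_mul_of_nonneg_left (hy i) hb
  simp only [dotProduct_add, dotProduct_smul, smul_eq_mul]
  calc L.offset i = a * L.offset i + b * L.offset i := by rw [← add_mul, hab, one_mul]
    _ ≤ _ := add_le_add h1 h2

/-- Along a direction killed by the active normals one can move a little both ways, since the
finitely many inactive constraints are strict. An extreme point is not the midpoint of such a
segment unless the direction is zero. -/
theorem isVertex_of_mem_extremePoints [Finite ι] {v : Fin n → ℝ}
    (hv : v ∈ Set.extremePoints ℝ L.carrier) : L.IsVertex v := by
  have hvP : v ∈ L.carrier := hv.1
  refine ⟨hvP, fun d hd => ?_⟩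
  have key : ∀ i, ∀ᶠ t : ℝ in nhds 0,
      L.offset i ≤ L.normal i ⬝ᵥ (v + t • d) ∧ L.offset i ≤ L.normal i ⬝ᵥ (v - t • d) := by
    intro i
    by_cases hi : L.normal i ⬝ᵥ v = L.offset i
    · have h0 := hd i hi
      filter_upwards with t
      simp only [dotProduct_add, dotProduct_sub, dotProduct_smul, h0, smul_zero, add_zero,
        sub_zero, and_self]
      exact hvP i
    · have hlt : L.offset i < L.normal i ⬝ᵥ v := lt_of_le_of_ne (hvP i) (Ne.symm hi)
      have c1 : Continuous fun t : ℝ => L.normal i ⬝ᵥ (v + t • d) := by fun_prop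
      have c2 : Continuous fun t : ℝ => L.normal i ⬝ᵥ (v - t • d) := by fun_prop
      have e1 := (c1.tendsto 0).eventually (lt_mem_nhds (a := L.offset i) (by simpa using hlt))
      have e2 := (c2.tendsto 0).eventually (lt_mem_nhds (a := L.offset i) (by simpa using hlt))
      filter_upwards [e1, e2] with t h1 h2
      exact ⟨h1.le, h2.le⟩
  obtain ⟨ε, hε, hb⟩ := Metric.eventually_nhds_iff.1 (Filter.eventually_all.2 key)
  have hlt : dist (ε / 2) 0 < ε := by
    rw [Real.dist_0_eq_abs, abs_of_pos (by positivity)]; linarith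
  have hb' := hb hlt
  have h1 : v + (ε / 2) • d ∈ L.carrier := fun i => (hb' i).1
  have h2 : v - (ε / 2) • d ∈ L.carrier := fun i => (hb' i).2
  have hseg : v ∈ openSegment ℝ (v + (ε / 2) • d) (v - (ε / 2) • d) := by
    refine ⟨1 / 2, 1 / 2, by norm_num, by norm_num, by norm_num, ?_⟩
    rw [← smul_add, add_add_sub_cancel, ← two_smul ℝ v, smul_smul]
    norm_num
  have h3 := hv.2 h1 h2 hseg
  have h4 : (ε / 2) • d = 0 := by simpa using h3
  exact (smul_eq_zero.1 h4).resolve_left (by positivity)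

/-- A face of the intersection is an extreme subset. -/
theorem isExtreme_face (k : ι) :
    IsExtreme ℝ L.carrier {x | x ∈ L.carrier ∧ L.normal k ⬝ᵥ x = L.offset k} := by
  refine ⟨fun x hx => hx.1, ?_⟩
  rintro x hx y hy z ⟨-, hz⟩ ⟨a, b, ha, hb, hab, rfl⟩
  refine ⟨hx, le_antisymm ?_ (hx k)⟩
  simp only [dotProduct_add, dotProduct_smul, smul_eq_mul] at hz
  have h2 := mul_le_mul_of_nonneg_left (hy k) hb.le
  have h3 : a * (L.normal k ⬝ᵥ x) ≤ a * L.offset k := by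
    have : L.offset k = a * L.offset k + b * L.offset k := by rw [← add_mul, hab, one_mul]
    linarith
  exact le_of_mul_le_mul_left h3 ha

theorem IsVertex.mem_extremePoints {v : Fin n → ℝ} (hv : L.IsVertex v) :
    v ∈ Set.extremePoints ℝ L.carrier := by
  refine ⟨hv.1, fun x hx y hy hseg => ?_⟩
  refine sub_eq_zero.1 (hv.2 _ fun k hk => ?_)
  have := (isExtreme_face (L := L) k).2 hx hy ⟨hv.1, hk⟩ hseg
  rw [dotProduct_sub, this.2, hk, sub_self]

/-- A vertex is determined by its set of active constraints. -/
theorem finite_setOf_isVertex [Finite ι] : {x | L.IsVertex x}.Finite := by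
  refine Set.Finite.of_finite_image
    (f := fun v => {k | L.normal k ⬝ᵥ v = L.offset k}) (Set.toFinite _) ?_
  intro v hv w hw hvw
  refine (sub_eq_zero.1 (hv.2 _ fun k hk => ?_)).symm
  have hk' : L.normal k ⬝ᵥ w = L.offset k := (Set.ext_iff.1 hvw k).1 hk
  rw [dotProduct_sub, hk, hk', sub_self]

end LabelledArrangement

/-! ### Passage from quasitoric pairs to arrangements -/

/-- The facets of a quasitoric pair with their labels. -/
def QuasitoricPair.arrangement {n : ℕ} (X : QuasitoricPair n) :
    LabelledArrangement n (Fin X.P.numFacets) where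
  normal := X.P.normal
  offset := X.P.offset
  orientation := X.P.orientation
  label := X.col

namespace QuasitoricPair

variable {n : ℕ} (X : QuasitoricPair n)

theorem isVertex_arrangement_iff {v : Fin n → ℝ} :
    X.arrangement.IsVertex v ↔ v ∈ X.P.vertices :=
  ⟨fun h => h.mem_extremePoints, fun h => LabelledArrangement.isVertex_of_mem_extremePoints h⟩

theorem isCorner_ordering (v : X.P.vertices) : X.arrangement.IsCorner v (X.P.ordering v) := by
  refine LabelledArrangement.IsCorner.of_isVertex (X.isVertex_arrangement_iff.2 v.2) fun k => ?_
  have h2 : Set.range (X.P.ordering v) = (X.P.facetsAt v : Set _) :=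
    Finset.range_orderEmbOfFin _ (X.P.card_facetsAt v.2)
  rw [h2]
  simp [OrientedSimplePolytope.facetsAt, arrangement]

theorem polynomial_arrangement : X.arrangement.polynomial = X.polynomial := by
  let _ : Fintype X.P.vertices := X.P.vertices_finite.fintype
  have hset : {x | X.arrangement.IsVertex x} = X.P.vertices :=
    Set.ext fun _ => X.isVertex_arrangement_iff
  unfold LabelledArrangement.polynomial
  rw [hset, ← finsum_set_coe_eq_finsum_mem, finsum_eq_sum_of_fintype]
  exact Finset.sum_congr rfl fun v _ => (X.isCorner_ordering v).monomial_eq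

/-- Moving an interior point slightly against `normal i` keeps it in the polytope and lowers the
`i`-th value, so the inequality was strict. -/
theorem exists_strict {n : ℕ} (P : OrientedSimplePolytope n) :
    ∃ x, ∀ i, P.offset i < P.normal i ⬝ᵥ x := by
  obtain ⟨x, hx⟩ := P.full_dim
  refine ⟨x, fun i => ?_⟩
  have hev : ∀ᶠ y in nhds x, ∀ j, P.offset j ≤ P.normal j ⬝ᵥ y :=
    mem_interior_iff_mem_nhds.1 hx
  have hc : Continuous fun t : ℝ => x - t • P.normal i := by fun_prop
  have ht : ∀ᶠ t in nhds (0 : ℝ), ∀ j, P.offset j ≤ P.normal j ⬝ᵥ (x - t • P.normal i) :=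
    (hc.tendsto' 0 x (by simp)).eventually hev
  obtain ⟨ε, hε, hb⟩ := Metric.eventually_nhds_iff.1 ht
  have h1 := hb (y := ε / 2) (by
    rw [Real.dist_0_eq_abs, abs_of_pos (by positivity)]; linarith) i
  simp only [dotProduct_sub, dotProduct_smul, smul_eq_mul] at h1
  have h2 : 0 < P.normal i ⬝ᵥ P.normal i := by
    refine lt_of_le_of_ne (Finset.sum_nonneg fun a _ => mul_self_nonneg _) (Ne.symm ?_)
    simpa using P.normal_ne_zero i
  have h3 : 0 < ε / 2 * (P.normal i ⬝ᵥ P.normal i) := by positivity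
  linarith

theorem isQuasitoric_arrangement : X.arrangement.IsQuasitoric where
  bounded := X.P.bounded
  interior := exists_strict X.P
  corner x hx := by
    have hv := X.isVertex_arrangement_iff.1 hx
    refine ⟨_, X.isCorner_ordering ⟨x, hv⟩, ?_⟩
    have hc := X.isCorner_ordering ⟨x, hv⟩
    have := X.star x hv _ hc.injective fun a => ⟨hv.1, (hc.active _).2 ⟨a, rfl⟩⟩
    rw [← Matrix.det_transpose, Int.isUnit_iff]
    exact this
  used k := by
    obtain ⟨z, hz⟩ := exists_strict X.P
    obtain ⟨y, hy, hyk⟩ := X.P.irredundant k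
    set F := {x | x ∈ X.arrangement.carrier ∧
      X.arrangement.normal k ⬝ᵥ x = X.arrangement.offset k} with hF
    have hFc : IsCompact F := by
      refine Metric.isCompact_of_isClosed_isBounded ?_
        (X.P.bounded.subset fun x hx => hx.1)
      exact LabelledArrangement.isClosed_carrier.inter
        (isClosed_eq (by fun_prop) continuous_const)
    -- The segment from the strictly interior `z` to `y`, which violates only the constraint `k`,
    -- meets the `k`-th hyperplane at a point of the polytope; the weights locate that point.
    have hFn : F.Nonempty := by
      set p := X.P.normal k ⬝ᵥ z - X.P.offset k with hp
      set q := X.P.offset k - X.P.normal k ⬝ᵥ y with hq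
      have hp0 : 0 < p := sub_pos.2 (hz k)
      have hq0 : 0 < q := sub_pos.2 hyk
      have hk : X.P.normal k ⬝ᵥ ((q / (p + q)) • z + (p / (p + q)) • y) = X.P.offset k := by
        simp only [dotProduct_add, dotProduct_smul, smul_eq_mul]
        have hpq : p + q ≠ 0 := by positivity
        rw [show X.P.normal k ⬝ᵥ z = p + X.P.offset k by rw [hp]; ring,
          show X.P.normal k ⬝ᵥ y = X.P.offset k - q by rw [hq]; ring]
        field_simp
        ring
      refine ⟨(q / (p + q)) • z + (p / (p + q)) • y, fun j => ?_, hk⟩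
      by_cases hj : j = k
      · subst hj
        exact hk.ge
      · have h1 := mul_le_mul_of_nonneg_left (hz j).le (show 0 ≤ q / (p + q) by positivity)
        have h2 := mul_le_mul_of_nonneg_left (hy j hj) (show 0 ≤ p / (p + q) by positivity)
        have h3 : q / (p + q) * X.P.offset j + p / (p + q) * X.P.offset j = X.P.offset j := by
          have hpq : p + q ≠ 0 := by positivity
          field_simp
          ring
        change X.P.offset j ≤ X.P.normal j ⬝ᵥ _
        simp only [dotProduct_add, dotProduct_smul, smul_eq_mul]
        linarith
    -- A compact face has an extreme point, which is extreme in the whole polytope because the face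
    -- is an extreme subset.
    obtain ⟨x, hx⟩ := hFc.extremePoints_nonempty hFn
    exact ⟨x, LabelledArrangement.isVertex_of_mem_extremePoints
      ((LabelledArrangement.isExtreme_face k).extremePoints_subset_extremePoints hx), hx.1.2⟩

end QuasitoricPair

/-! ### Passage from arrangements back to quasitoric pairs -/

namespace LabelledArrangement

variable {n : ℕ}

/-- Each constraint active at a corner can be violated alone. -/
theorem IsCorner.exists_violating {ι : Type} [Finite ι] {L : LabelledArrangement n ι}
    {x : Fin n → ℝ} {i : Fin n → ι} (h : L.IsCorner x i) (a : Fin n) :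
    ∃ y, (∀ j, j ≠ i a → L.offset j ≤ L.normal j ⬝ᵥ y) ∧
      L.normal (i a) ⬝ᵥ y < L.offset (i a) := by
  -- The direction `d` leaves the `a`-th active half-space and stays on the hyperplanes of the other
  -- active ones.
  set d := (L.normals i)⁻¹ *ᵥ Pi.single a (-1) with hd
  have hN : L.normals i *ᵥ d = Pi.single a (-1) := by
    rw [hd, Matrix.mulVec_mulVec, Matrix.mul_nonsing_inv _ h.det_ne.isUnit, Matrix.one_mulVec]
  have hNa : ∀ b, L.normal (i b) ⬝ᵥ d = Pi.single (M := fun _ => ℝ) a (-1) b :=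
    fun b => congrFun hN b
  have key : ∀ j, ∀ᶠ t : ℝ in nhds 0, 0 < t → j ≠ i a →
      L.offset j ≤ L.normal j ⬝ᵥ (x + t • d) := by
    intro j
    by_cases hj : L.normal j ⬝ᵥ x = L.offset j
    · filter_upwards with t _ hja
      obtain ⟨b, rfl⟩ := (h.active j).1 hj
      have hba : b ≠ a := fun h => hja (by rw [h])
      rw [dotProduct_add, dotProduct_smul, hNa, Pi.single_eq_of_ne hba, smul_zero, add_zero, hj]
    · have hlt : L.offset j < L.normal j ⬝ᵥ x := lt_of_le_of_ne (h.mem j) (Ne.symm hj)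
      have c1 : Continuous fun t : ℝ => L.normal j ⬝ᵥ (x + t • d) := by fun_prop
      filter_upwards [(c1.tendsto 0).eventually
        (lt_mem_nhds (a := L.offset j) (by simpa using hlt))] with t h1 _ _
      exact h1.le
  obtain ⟨ε, hε, hb⟩ := Metric.eventually_nhds_iff.1 (Filter.eventually_all.2 key)
  have hlt : dist (ε / 2) 0 < ε := by
    rw [Real.dist_0_eq_abs, abs_of_pos (by positivity)]; linarith
  refine ⟨x + (ε / 2) • d, fun j hj => hb hlt j (by positivity) hj, ?_⟩
  rw [dotProduct_add, dotProduct_smul, hNa, Pi.single_eq_same, (h.active _).2 ⟨a, rfl⟩,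
    smul_eq_mul]
  linarith

theorem IsQuasitoric.exists_corner {ι : Type} {L : LabelledArrangement n ι}
    (hL : L.IsQuasitoric) (k : ι) : ∃ x i, L.IsCorner x i ∧ k ∈ Set.range i := by
  obtain ⟨x, hx, hk⟩ := hL.used k
  obtain ⟨i, hi, -⟩ := hL.corner x hx
  exact ⟨x, i, hi, (hi.active k).1 hk⟩

/-- The quasitoric pair defined by a labelled arrangement. -/
def IsQuasitoric.pair {m : ℕ} {L : LabelledArrangement n (Fin m)} (hL : L.IsQuasitoric) :
    QuasitoricPair n where
  P :=
    { numFacets := m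
      normal := L.normal
      offset := L.offset
      orientation := L.orientation
      normal_ne_zero := fun k h0 => by
        obtain ⟨x, i, hi, a, rfl⟩ := hL.exists_corner k
        exact hi.det_ne (Matrix.det_eq_zero_of_row_eq_zero a fun b => congrFun h0 b)
      bounded := hL.bounded
      full_dim := by
        obtain ⟨x, hx⟩ := hL.interior
        refine ⟨x, mem_interior_iff_mem_nhds.2 ?_⟩
        have : ∀ᶠ y in nhds x, ∀ k, L.offset k < L.normal k ⬝ᵥ y := by
          refine Filter.eventually_all.2 fun k => ?_
          have hc : Continuous fun y : Fin n → ℝ => L.normal k ⬝ᵥ y := by fun_prop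
          exact (hc.tendsto x).eventually (lt_mem_nhds (hx k))
        filter_upwards [this] with y hy k
        exact (hy k).le
      irredundant := fun k => by
        obtain ⟨x, i, hi, a, rfl⟩ := hL.exists_corner k
        exact hi.exists_violating a
      simple := fun v hv => by
        obtain ⟨i, hi, -⟩ := hL.corner v (isVertex_of_mem_extremePoints hv)
        have : (Finset.univ.filter fun k => L.normal k ⬝ᵥ v = L.offset k) =
            Finset.univ.map ⟨i, hi.injective⟩ := by
          ext k
          simp [hi.active k]
        rw [this, Finset.card_map, Finset.card_univ, Fintype.card_fin] }
  col := L.label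
  star v hv i hinj hmem := by
    obtain ⟨j, hj, -⟩ := hL.corner v (isVertex_of_mem_extremePoints hv)
    have hi : L.IsCorner v i := by
      refine IsCorner.of_isVertex (isVertex_of_mem_extremePoints hv) fun k => ?_
      refine ⟨fun hk => ?_, ?_⟩
      · have hsub : Finset.univ.map ⟨i, hinj⟩ ⊆ Finset.univ.map ⟨j, hj.injective⟩ := by
          intro k hk
          obtain ⟨a, -, rfl⟩ := Finset.mem_map.1 hk
          obtain ⟨b, hb⟩ := (hj.active (i a)).1 (hmem a).2
          exact Finset.mem_map.2 ⟨b, Finset.mem_univ _, hb⟩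
        have heq := Finset.eq_of_subset_of_card_le hsub (by simp)
        obtain ⟨b, hb⟩ := (hj.active k).1 hk
        have : k ∈ Finset.univ.map ⟨j, hj.injective⟩ :=
          Finset.mem_map.2 ⟨b, Finset.mem_univ _, hb⟩
        rw [← heq] at this
        obtain ⟨a, -, ha⟩ := Finset.mem_map.1 this
        exact ⟨a, ha⟩
      · rintro ⟨a, rfl⟩
        exact (hmem a).2
    have := hL.isUnit_labels hi
    rw [← Matrix.det_transpose, Int.isUnit_iff] at this
    exact this

theorem IsQuasitoric.isQuasitoricPolynomial_fin {m : ℕ} {L : LabelledArrangement n (Fin m)}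
    (hL : L.IsQuasitoric) : IsQuasitoricPolynomial L.polynomial :=
  ⟨hL.pair, hL.pair.polynomial_arrangement.symm⟩

end LabelledArrangement

/-! ### Invariance under affine changes of coordinates -/

/-- An affine change of coordinates `x ↦ B (x - v)` together with a renumbering and a rescaling
of the constraints. -/
structure AffineEquivalence {n : ℕ} {ι ι' : Type} (L : LabelledArrangement n ι)
    (L' : LabelledArrangement n ι') where
  index : ι' ≃ ι
  linear : Matrix (Fin n) (Fin n) ℝ
  det_ne : linear.det ≠ 0
  origin : Fin n → ℝ
  scale : ι' → ℝ
  scale_pos : ∀ k, 0 < scale k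
  slack : ∀ k x, L'.normal k ⬝ᵥ (linear *ᵥ (x - origin)) - L'.offset k =
    scale k * (L.normal (index k) ⬝ᵥ x - L.offset (index k))
  orientation : (L'.orientation : ℤ) = L.orientation * (SignType.sign linear.det : ℤ)
  label : ∀ k, L'.label k = L.label (index k)

namespace AffineEquivalence

variable {n : ℕ} {ι ι' : Type} {L : LabelledArrangement n ι} {L' : LabelledArrangement n ι'}
  (E : AffineEquivalence L L')

/-- The underlying change of coordinates. -/
def toFun (x : Fin n → ℝ) : Fin n → ℝ := E.linear *ᵥ (x - E.origin)

theorem injective : Function.Injective E.toFun := by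
  intro x y hxy
  have h : E.linear *ᵥ (x - E.origin) = E.linear *ᵥ (y - E.origin) := hxy
  have h2 := congrArg (fun z => E.linear⁻¹ *ᵥ z) h
  simpa [Matrix.mulVec_mulVec, Matrix.nonsing_inv_mul _ E.det_ne.isUnit] using h2

theorem surjective : Function.Surjective E.toFun := by
  intro y
  refine ⟨E.linear⁻¹ *ᵥ y + E.origin, ?_⟩
  rw [toFun, add_sub_cancel_right, Matrix.mulVec_mulVec,
    Matrix.mul_nonsing_inv _ E.det_ne.isUnit, Matrix.one_mulVec]

theorem normal_mulVec (k : ι') (d : Fin n → ℝ) :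
    L'.normal k ⬝ᵥ (E.linear *ᵥ d) = E.scale k * (L.normal (E.index k) ⬝ᵥ d) := by
  have h1 := E.slack k (d + E.origin)
  have h2 := E.slack k E.origin
  rw [add_sub_cancel_right, dotProduct_add] at h1
  rw [sub_self, Matrix.mulVec_zero, dotProduct_zero] at h2
  linear_combination h1 - h2

theorem lt_iff (k : ι') (x : Fin n → ℝ) :
    L'.offset k < L'.normal k ⬝ᵥ E.toFun x ↔
      L.offset (E.index k) < L.normal (E.index k) ⬝ᵥ x := by
  rw [← sub_pos, toFun, E.slack, mul_pos_iff_of_pos_left (E.scale_pos k), sub_pos]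

theorem le_iff (k : ι') (x : Fin n → ℝ) :
    L'.offset k ≤ L'.normal k ⬝ᵥ E.toFun x ↔
      L.offset (E.index k) ≤ L.normal (E.index k) ⬝ᵥ x := by
  rw [← sub_nonneg, toFun, E.slack, mul_nonneg_iff_of_pos_left (E.scale_pos k), sub_nonneg]

theorem eq_iff (k : ι') (x : Fin n → ℝ) :
    L'.normal k ⬝ᵥ E.toFun x = L'.offset k ↔
      L.normal (E.index k) ⬝ᵥ x = L.offset (E.index k) := by
  rw [← sub_eq_zero, toFun, E.slack, mul_eq_zero_iff_left (E.scale_pos k).ne', sub_eq_zero]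

theorem mem_carrier_iff (x : Fin n → ℝ) : E.toFun x ∈ L'.carrier ↔ x ∈ L.carrier := by
  refine ⟨fun h k => ?_, fun h k => (E.le_iff k x).2 (h _)⟩
  have := (E.le_iff (E.index.symm k) x).1 (h _)
  rwa [E.index.apply_symm_apply] at this

theorem isVertex_iff (x : Fin n → ℝ) : L'.IsVertex (E.toFun x) ↔ L.IsVertex x := by
  refine and_congr (E.mem_carrier_iff x) ⟨fun h d hd => ?_, fun h d hd => ?_⟩
  · have h0 := h (E.linear *ᵥ d) fun k hk => by
      rw [E.normal_mulVec, hd _ ((E.eq_iff k x).1 hk), mul_zero]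
    have h2 := congrArg (fun z => E.linear⁻¹ *ᵥ z) h0
    simpa [Matrix.mulVec_mulVec, Matrix.nonsing_inv_mul _ E.det_ne.isUnit] using h2
  · have hd' : d = E.linear *ᵥ (E.linear⁻¹ *ᵥ d) := by
      rw [Matrix.mulVec_mulVec, Matrix.mul_nonsing_inv _ E.det_ne.isUnit, Matrix.one_mulVec]
    rw [hd', h (E.linear⁻¹ *ᵥ d), Matrix.mulVec_zero]
    intro k hk
    have h1 := hd (E.index.symm k) ((E.eq_iff _ x).2 (by rwa [E.index.apply_symm_apply]))
    rw [hd', E.normal_mulVec, E.index.apply_symm_apply] at h1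
    exact (mul_eq_zero.1 h1).resolve_left (E.scale_pos _).ne'

theorem det_normals (i : Fin n → ι') :
    (L'.normals i).det * E.linear.det =
      (∏ a, E.scale (i a)) * (L.normals fun a => E.index (i a)).det := by
  have : L'.normals i * E.linear =
      Matrix.diagonal (fun a => E.scale (i a)) * L.normals fun a => E.index (i a) := by
    ext a b
    have := E.normal_mulVec (i a) (Pi.single b 1)
    rw [Matrix.mulVec_single_one, dotProduct_single_one] at this
    rw [Matrix.diagonal_mul]
    exact this
  rw [← Matrix.det_mul, this, Matrix.det_mul, Matrix.det_diagonal]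

/-- The sign of `linear.det` by which the determinants of normals change is absorbed by
`orientation`; the scales are positive and do not affect signs. -/
theorem term_eq (i : Fin n → ι') : L'.term i = L.term fun a => E.index (i a) := by
  have hs : SignType.sign (L'.normals i).det * SignType.sign E.linear.det =
      SignType.sign (L.normals fun a => E.index (i a)).det := by
    rw [← sign_mul, E.det_normals, sign_mul,
      sign_pos (Finset.prod_pos fun a _ => E.scale_pos _), one_mul]
  unfold LabelledArrangement.term
  simp only [E.label, E.orientation, ← hs]
  congr 1
  push_cast
  ring

theorem isCorner_iff (x : Fin n → ℝ) (i : Fin n → ι') :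
    L'.IsCorner (E.toFun x) i ↔ L.IsCorner x fun a => E.index (i a) := by
  have hmem : ∀ k, k ∈ Set.range i ↔ E.index k ∈ Set.range fun a => E.index (i a) := by
    intro k
    simp
  constructor
  · intro h
    refine LabelledArrangement.IsCorner.of_isVertex ((E.isVertex_iff x).1 h.isVertex) fun k => ?_
    obtain ⟨k, rfl⟩ := E.index.surjective k
    rw [← E.eq_iff, h.active, hmem]
  · intro h
    refine LabelledArrangement.IsCorner.of_isVertex ((E.isVertex_iff x).2 h.isVertex) fun k => ?_
    rw [E.eq_iff, h.active, hmem]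

theorem exists_isCorner {x : Fin n → ℝ} {i : Fin n → ι} (h : L.IsCorner x i) :
    ∃ j : Fin n → ι', (i = fun a => E.index (j a)) ∧ L'.IsCorner (E.toFun x) j := by
  have hi : i = fun a => E.index (E.index.symm (i a)) := by simp
  exact ⟨fun a => E.index.symm (i a), hi, (E.isCorner_iff _ _).2 (hi ▸ h)⟩

theorem isQuasitoric (E : AffineEquivalence L L') (hL : L.IsQuasitoric) : L'.IsQuasitoric where
  bounded := by
    have hc : Continuous E.toFun := by
      unfold toFun
      fun_prop
    refine (hL.isCompact.image hc).isBounded.subset fun y hy => ?_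
    obtain ⟨x, rfl⟩ := E.surjective y
    exact ⟨x, (E.mem_carrier_iff x).1 hy, rfl⟩
  interior := by
    obtain ⟨x, hx⟩ := hL.interior
    exact ⟨E.toFun x, fun k => (E.lt_iff k x).2 (hx _)⟩
  corner y hy := by
    obtain ⟨x, rfl⟩ := E.surjective y
    obtain ⟨i, hi, hu⟩ := hL.corner x ((E.isVertex_iff x).1 hy)
    obtain ⟨j, rfl, hj⟩ := E.exists_isCorner hi
    refine ⟨j, hj, ?_⟩
    have : L'.labels j = L.labels fun a => E.index (j a) := by
      ext a b
      simp [LabelledArrangement.labels, E.label]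
    rwa [this]
  used k := by
    obtain ⟨x, hx, hk⟩ := hL.used (E.index k)
    exact ⟨E.toFun x, (E.isVertex_iff x).2 hx, (E.eq_iff k x).2 hk⟩

theorem polynomial_eq (E : AffineEquivalence L L') (hL : L.IsQuasitoric) :
    L'.polynomial = L.polynomial := by
  unfold LabelledArrangement.polynomial
  refine (finsum_mem_eq_of_bijOn E.toFun ⟨fun x hx => (E.isVertex_iff x).2 hx,
    E.injective.injOn, fun y hy => ?_⟩ fun x hx => ?_).symm
  · obtain ⟨x, rfl⟩ := E.surjective y
    exact ⟨x, (E.isVertex_iff x).1 hy, rfl⟩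
  · obtain ⟨i, hi, -⟩ := hL.corner x hx
    obtain ⟨j, rfl, hj⟩ := E.exists_isCorner hi
    rw [hi.monomial_eq, hj.monomial_eq, E.term_eq]

end AffineEquivalence

/-! ### Renumbering, and coordinates centred at a corner -/

namespace LabelledArrangement

variable {n : ℕ}

/-- Renumbering of the constraints. -/
def reindex {ι ι' : Type} (L : LabelledArrangement n ι) (e : ι' ≃ ι) :
    LabelledArrangement n ι' where
  normal k := L.normal (e k)
  offset k := L.offset (e k)
  orientation := L.orientation
  label k := L.label (e k)

/-- Renumbering is an affine equivalence. -/
def reindexEquivalence {ι ι' : Type} (L : LabelledArrangement n ι) (e : ι' ≃ ι) :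
    AffineEquivalence L (L.reindex e) where
  index := e
  linear := 1
  det_ne := by simp
  origin := 0
  scale _ := 1
  scale_pos _ := one_pos
  slack k x := by simp [reindex]
  orientation := by simp [reindex]
  label _ := rfl

theorem IsQuasitoric.isQuasitoricPolynomial {ι : Type} [Finite ι] {L : LabelledArrangement n ι}
    (hL : L.IsQuasitoric) : IsQuasitoricPolynomial L.polynomial := by
  have E := L.reindexEquivalence (Finite.equivFin ι).symm
  rw [← E.polynomial_eq hL]
  exact (E.isQuasitoric hL).isQuasitoricPolynomial_fin

/-- The arrangement `{x | 0 ≤ x, ⟨α j, x⟩ ≤ 1}`. -/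
def cornered {κ : Type} (α : κ → Fin n → ℝ) (o : ℤˣ) (l : Fin n ⊕ κ → J n) :
    LabelledArrangement n (Fin n ⊕ κ) where
  normal := Sum.elim (fun a => Pi.single a 1) fun j => -α j
  offset := Sum.elim 0 fun _ => -1
  orientation := o
  label := l

/-- Affine coordinates in which a given corner is the origin and its constraints are the
coordinate half-spaces. -/
theorem IsCorner.exists_cornered {ι : Type} [Finite ι] {L : LabelledArrangement n ι}
    {v : Fin n → ℝ} {i : Fin n → ι} (h : L.IsCorner v i) :
    ∃ (κ : Type) (_ : Finite κ) (α : κ → Fin n → ℝ) (o : ℤˣ) (l : Fin n ⊕ κ → J n),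
      (o : ℤ) = L.orientation * (SignType.sign (L.normals i).det : ℤ) ∧
      (∀ a, l (Sum.inl a) = L.label (i a)) ∧
      Nonempty (AffineEquivalence L (cornered α o l)) := by
  set B := L.normals i with hB
  let κ := {k : ι // k ∉ Set.range i}
  let s : κ → ℝ := fun k => L.normal k ⬝ᵥ v - L.offset k
  have hs : ∀ k, 0 < s k := fun k =>
    sub_pos.2 (lt_of_le_of_ne (h.mem _) fun h' => k.2 ((h.active _).1 h'.symm))
  let e : Fin n ⊕ κ ≃ ι := Equiv.ofBijective (Sum.elim i Subtype.val) (by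
    constructor
    · rintro (a | k) (b | k') hab
      · exact congrArg _ (h.injective hab)
      · exact absurd ⟨a, hab⟩ k'.2
      · exact absurd ⟨b, hab.symm⟩ k.2
      · exact congrArg _ (Subtype.ext hab)
    · intro k
      by_cases hk : k ∈ Set.range i
      · obtain ⟨a, rfl⟩ := hk
        exact ⟨Sum.inl a, rfl⟩
      · exact ⟨Sum.inr ⟨k, hk⟩, rfl⟩)
  obtain ⟨o, ho⟩ : ∃ o : ℤˣ, (o : ℤ) = L.orientation * (SignType.sign B.det : ℤ) := by
    rcases lt_or_gt_of_ne h.det_ne with h' | h'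
    · exact ⟨-L.orientation, by simp [hB, sign_neg h']⟩
    · exact ⟨L.orientation, by simp [hB, sign_pos h']⟩
  -- In the coordinates `B (x - v)` the `a`-th coordinate is the slack of the constraint `i a`.
  -- Every other constraint has slack `s k > 0` at `v`; dividing by it makes the offset `-1`.
  refine ⟨κ, inferInstance, fun k => -(s k)⁻¹ • (L.normal k ᵥ* B⁻¹), o,
    fun k => L.label (e k), ho, fun a => rfl, ⟨?_⟩⟩
  exact
    { index := e
      linear := B
      det_ne := h.det_ne
      origin := v
      scale := Sum.elim 1 fun k => (s k)⁻¹
      scale_pos := by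
        rintro (a | k)
        · exact one_pos
        · exact inv_pos.2 (hs k)
      slack := by
        rintro (a | k) x
        · have h1 : L.normal (i a) ⬝ᵥ v = L.offset (i a) := (h.active _).2 ⟨a, rfl⟩
          change Pi.single a 1 ⬝ᵥ (B *ᵥ (x - v)) - 0 =
            1 * (L.normal (i a) ⬝ᵥ x - L.offset (i a))
          rw [single_one_dotProduct, hB, normals_mulVec, dotProduct_sub, h1]
          ring
        · have h1 := (hs k).ne'
          change -(-(s k)⁻¹ • (L.normal k ᵥ* B⁻¹)) ⬝ᵥ (B *ᵥ (x - v)) - -1 =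
            (s k)⁻¹ * (L.normal k ⬝ᵥ x - L.offset k)
          rw [neg_smul, neg_neg, smul_dotProduct, Matrix.dotProduct_mulVec,
            Matrix.vecMul_vecMul, Matrix.nonsing_inv_mul _ h.det_ne.isUnit, Matrix.vecMul_one,
            dotProduct_sub, smul_eq_mul]
          have h2 : (s k)⁻¹ * s k = 1 := inv_mul_cancel₀ h1
          have h3 : s k = L.normal k ⬝ᵥ v - L.offset k := rfl
          rw [h3] at h2 ⊢
          linear_combination -h2
      orientation := ho
      label := fun _ => rfl }

end LabelledArrangement

/-! ### Polytopes with a corner at the origin -/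

namespace LabelledArrangement

variable {n : ℕ}

section cornered

variable {κ : Type} {α : κ → Fin n → ℝ} {o : ℤˣ} {l : Fin n ⊕ κ → J n}

theorem cornered_normal_inl (a : Fin n) (x : Fin n → ℝ) :
    (cornered α o l).normal (Sum.inl a) ⬝ᵥ x = x a :=
  single_one_dotProduct a x

theorem cornered_normal_inr (j : κ) (x : Fin n → ℝ) :
    (cornered α o l).normal (Sum.inr j) ⬝ᵥ x = -(α j ⬝ᵥ x) :=
  neg_dotProduct _ _

theorem cornered_active_inl (a : Fin n) (x : Fin n → ℝ) :
    (cornered α o l).normal (Sum.inl a) ⬝ᵥ x = (cornered α o l).offset (Sum.inl a) ↔ x a = 0 := by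
  rw [cornered_normal_inl]
  rfl

theorem cornered_active_inr (j : κ) (x : Fin n → ℝ) :
    (cornered α o l).normal (Sum.inr j) ⬝ᵥ x = (cornered α o l).offset (Sum.inr j) ↔
      α j ⬝ᵥ x = 1 := by
  rw [cornered_normal_inr]
  exact neg_inj

theorem mem_cornered {x : Fin n → ℝ} :
    x ∈ (cornered α o l).carrier ↔ (∀ a, 0 ≤ x a) ∧ ∀ j, α j ⬝ᵥ x ≤ 1 := by
  refine ⟨fun h => ⟨fun a => ?_, fun j => ?_⟩, ?_⟩
  · have := h (Sum.inl a)
    rwa [cornered_normal_inl] at this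
  · have := h (Sum.inr j)
    rw [cornered_normal_inr] at this
    exact neg_le_neg_iff.1 this
  · rintro ⟨h1, h2⟩ (a | j)
    · rw [cornered_normal_inl]
      exact h1 a
    · rw [cornered_normal_inr]
      exact neg_le_neg (h2 j)

theorem normals_cornered_inl : (cornered α o l).normals Sum.inl = 1 := by
  ext a b
  simp [normals, cornered, Matrix.one_apply, Pi.single_apply, eq_comm]

theorem isCorner_cornered_zero : (cornered α o l).IsCorner 0 Sum.inl where
  mem := mem_cornered.2 ⟨fun _ => le_rfl, fun j => by simp⟩
  active := by
    rintro (a | j)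
    · exact iff_of_true ((cornered_active_inl a 0).2 rfl) ⟨a, rfl⟩
    · exact iff_of_false
        (fun h => absurd ((cornered_active_inr j 0).1 h) (by simp)) (by simp)
  det_ne := by simp [normals_cornered_inl]

/-- The normals at the origin form the identity matrix, so the orientation is the sign of the
monomial there. -/
theorem term_cornered_inl :
    (cornered α o l).term Sum.inl = (o : ℤ) • wedge fun a => l (Sum.inl a) := by
  rw [term, normals_cornered_inl, Matrix.det_one, sign_one]
  simp [cornered]

theorem IsVertex.exists_active_inr {x : Fin n → ℝ} (h : (cornered α o l).IsVertex x)
    (hx : x ≠ 0) : ∃ j, α j ⬝ᵥ x = 1 := by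
  by_contra! hne
  refine hx (h.2 x ?_)
  rintro (a | j) hk
  · exact hk
  · exact absurd ((cornered_active_inr j x).1 hk) (hne j)

/-- A bounded corner contains no ray. -/
theorem eq_zero_of_isBounded_cornered (hb : Bornology.IsBounded (cornered α o l).carrier)
    {x : Fin n → ℝ} (hx : ∀ a, 0 ≤ x a) (hα : ∀ j, α j ⬝ᵥ x ≤ 0) : x = 0 := by
  by_contra hne
  obtain ⟨R, hR⟩ := hb.exists_norm_le
  have hpos : 0 < ‖x‖ := norm_pos_iff.2 hne
  have hR0 : 0 ≤ R := (norm_nonneg _).trans (hR 0 isCorner_cornered_zero.mem)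
  have ht : 0 ≤ (R + 1) / ‖x‖ := by positivity
  have := hR (((R + 1) / ‖x‖) • x) (mem_cornered.2 ⟨fun a => mul_nonneg ht (hx a), fun j => by
    rw [dotProduct_smul, smul_eq_mul]
    linarith [mul_nonpos_of_nonneg_of_nonpos ht (hα j)]⟩)
  rw [norm_smul, Real.norm_of_nonneg ht, div_mul_cancel₀ _ hpos.ne'] at this
  linarith

theorem dotProduct_le_mul_sum {v x : Fin n → ℝ} {A : ℝ} (hv : ∀ b, v b ≤ A)
    (hx : ∀ b, 0 ≤ x b) : v ⬝ᵥ x ≤ A * ∑ b, x b := by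
  rw [Finset.mul_sum]
  exact Finset.sum_le_sum fun b _ => mul_le_mul_of_nonneg_right (hv b) (hx b)

theorem exists_entries_le [Finite κ] (α : κ → Fin n → ℝ) : ∃ A, 0 < A ∧ ∀ j b, α j b ≤ A := by
  obtain ⟨A, hA⟩ := (Set.finite_range fun p : κ × Fin n => α p.1 p.2).bddAbove
  exact ⟨max A 1, by positivity, fun j b => (hA ⟨(j, b), rfl⟩).trans (le_max_left _ _)⟩

/-- In dimension at least two, each facet at the origin contains another vertex. -/
theorem IsQuasitoric.exists_isVertex_ne_zero [Finite κ] (hn : 1 < n)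
    (hL : (cornered α o l).IsQuasitoric) (a : Fin n) :
    ∃ x, (cornered α o l).IsVertex x ∧ x a = 0 ∧ x ≠ 0 := by
  set F := {x | x ∈ (cornered α o l).carrier ∧
    (cornered α o l).normal (Sum.inl a) ⬝ᵥ x = (cornered α o l).offset (Sum.inl a)} with hF
  have hFconv : Convex ℝ F := by
    refine convex_carrier.inter fun x hx y hy s t hs ht hst => ?_
    have hx' := (cornered_active_inl a x).1 hx
    have hy' := (cornered_active_inl a y).1 hy
    exact (cornered_active_inl a _).2 (by simp [hx', hy'])
  have hFc : IsCompact F := hL.isCompact.inter_right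
    (isClosed_eq (by fun_prop) continuous_const)
  -- If the origin were the only vertex on the facet, Krein–Milman would reduce the facet to a
  -- point; but it contains a positive multiple of a second basis vector.
  by_contra! hno
  have hsub : Set.extremePoints ℝ F ⊆ {0} := fun x hx =>
    hno x (isVertex_of_mem_extremePoints
      ((isExtreme_face _).extremePoints_subset_extremePoints hx))
      ((cornered_active_inl a x).1 hx.1.2)
  have hF0 : F ⊆ {0} := by
    rw [← closure_convexHull_extremePoints hFc hFconv]
    exact (closure_mono (convexHull_mono hsub)).trans (by simp)
  obtain ⟨A, hA, hαA⟩ := exists_entries_le α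
  have : Nontrivial (Fin n) := Fin.nontrivial_iff_two_le.2 hn
  obtain ⟨b, hb⟩ := exists_ne a
  have hmem : Pi.single b A⁻¹ ∈ F := by
    refine ⟨mem_cornered.2 ⟨fun c => ?_, fun j => ?_⟩, (cornered_active_inl a _).2 ?_⟩
    · by_cases hc : c = b
      · subst hc
        simpa using hA.le
      · simp [hc]
    · rw [dotProduct_single, ← div_eq_mul_inv]
      exact (div_le_one hA).2 (hαA j b)
    · simp [hb.symm]
  have := hF0 hmem
  simp [hA.ne'] at this

end cornered

/-! ### The connected sum at two corners -/

section connectedSum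

variable {κ₁ κ₂ : Type}

/-- The corner of `{x | 0 ≤ x, ⟨α j, x⟩ ≤ 1}` at the origin is cut off by the image of
`{y | 0 ≤ y, ⟨γ k, y⟩ ≤ 1}` under the projective involution `y ↦ y / (M ∑ y - 1)`. -/
def connectedSum (α : κ₁ → Fin n → ℝ) (γ : κ₂ → Fin n → ℝ) (M : ℝ) (o : ℤˣ)
    (l : Fin n ⊕ (κ₁ ⊕ κ₂) → J n) : LabelledArrangement n (Fin n ⊕ (κ₁ ⊕ κ₂)) where
  normal := Sum.elim (fun a => Pi.single a 1)
    (Sum.elim (fun j => -α j) fun k => (fun _ => M) - γ k)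
  offset := Sum.elim 0 (Sum.elim (fun _ => -1) fun _ => 1)
  orientation := o
  label := l

/-- The cut in `connectedSum` is close enough to the origin. -/
structure GluingBound (α : κ₁ → Fin n → ℝ) (γ : κ₂ → Fin n → ℝ) (A G M : ℝ) : Prop where
  pos₁ : 0 < A
  pos₂ : 0 < G
  le₁ : ∀ j b, α j b ≤ A
  le₂ : ∀ k b, γ k b ≤ G
  -- A nonzero vertex of the first polytope has `1 ≤ A ∑ x`, hence `1 < (M - G) ∑ x`, and satisfies
  -- every cut strictly. One of the second has `1 ≤ G ∑ y`, hence `1 < (M - A) ∑ y`, and its image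
  -- satisfies every constraint from `α` strictly.
  lt : A + G < M

theorem exists_gluingBound [Finite κ₁] [Finite κ₂] (α : κ₁ → Fin n → ℝ) (γ : κ₂ → Fin n → ℝ) :
    ∃ A G M, GluingBound α γ A G M := by
  obtain ⟨A, hA, hA'⟩ := exists_entries_le α
  obtain ⟨G, hG, hG'⟩ := exists_entries_le γ
  exact ⟨A, G, A + G + 1, hA, hG, hA', hG', by linarith⟩

variable {α : κ₁ → Fin n → ℝ} {γ : κ₂ → Fin n → ℝ} {A G M : ℝ} {o o' : ℤˣ}
  {l : Fin n ⊕ (κ₁ ⊕ κ₂) → J n} {l₁ : Fin n ⊕ κ₁ → J n} {l₂ : Fin n ⊕ κ₂ → J n}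

theorem connectedSum_normal_cut (k : κ₂) (x : Fin n → ℝ) :
    (connectedSum α γ M o l).normal (Sum.inr (Sum.inr k)) ⬝ᵥ x =
      M * ∑ b, x b - γ k ⬝ᵥ x := by
  change ((fun _ => M) - γ k) ⬝ᵥ x = _
  rw [sub_dotProduct, dotProduct, Finset.mul_sum]

theorem connectedSum_active_inl (a : Fin n) (x : Fin n → ℝ) :
    (connectedSum α γ M o l).normal (Sum.inl a) ⬝ᵥ x =
      (connectedSum α γ M o l).offset (Sum.inl a) ↔ x a = 0 :=
  cornered_active_inl (α := α) (o := o) (l := fun k => l (Sum.map id Sum.inl k)) a x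

theorem connectedSum_active_outer (j : κ₁) (x : Fin n → ℝ) :
    (connectedSum α γ M o l).normal (Sum.inr (Sum.inl j)) ⬝ᵥ x =
      (connectedSum α γ M o l).offset (Sum.inr (Sum.inl j)) ↔ α j ⬝ᵥ x = 1 :=
  cornered_active_inr (α := α) (o := o) (l := fun k => l (Sum.map id Sum.inl k)) j x

theorem connectedSum_active_cut (k : κ₂) (x : Fin n → ℝ) :
    (connectedSum α γ M o l).normal (Sum.inr (Sum.inr k)) ⬝ᵥ x =
      (connectedSum α γ M o l).offset (Sum.inr (Sum.inr k)) ↔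
      M * ∑ b, x b - γ k ⬝ᵥ x = 1 := by
  rw [connectedSum_normal_cut]
  rfl

theorem mem_connectedSum {x : Fin n → ℝ} :
    x ∈ (connectedSum α γ M o l).carrier ↔
      (∀ a, 0 ≤ x a) ∧ (∀ j, α j ⬝ᵥ x ≤ 1) ∧ ∀ k, 1 ≤ M * ∑ b, x b - γ k ⬝ᵥ x := by
  have h1 := mem_cornered (α := α) (o := o) (l := fun k => l (Sum.map id Sum.inl k)) (x := x)
  rw [← and_assoc, ← h1]
  refine ⟨fun h => ⟨?_, fun k => ?_⟩, ?_⟩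
  · rintro (a | j)
    · exact h (Sum.inl a)
    · exact h (Sum.inr (Sum.inl j))
  · rw [← connectedSum_normal_cut (α := α) (o := o) (l := l)]
    exact h (Sum.inr (Sum.inr k))
  · rintro ⟨h2, h3⟩ (a | j | k)
    · exact h2 (Sum.inl a)
    · exact h2 (Sum.inr j)
    · rw [connectedSum_normal_cut]
      exact h3 k

theorem normals₁ (i : Fin n → Fin n ⊕ κ₁) :
    (connectedSum α γ M o l).normals (fun a => Sum.map id Sum.inl (i a)) =
      (cornered α o' l₁).normals i := by
  ext a b
  rcases h' : i a with c | j <;> simp [normals, h', connectedSum, cornered]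

/-- The matrix determinant lemma for a projective change of coordinates. -/
theorem det_normals₂ {y : Fin n → ℝ} {i : Fin n → Fin n ⊕ κ₂}
    (h : (cornered γ o' l₂).IsCorner y i) :
    ((connectedSum α γ M o l).normals fun a => Sum.map id Sum.inr (i a)).det =
      ((cornered γ o' l₂).normals i).det * (1 - M * ∑ b, y b) := by
  let C : Matrix (Fin n) Unit ℝ := Matrix.replicateCol Unit (-M • y)
  let R : Matrix Unit (Fin n) ℝ := Matrix.replicateRow Unit 1
  -- The rank-one factor adds to each row `N` the multiple `-M ⟨N, y⟩` of the all-ones row. As `y`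
  -- lies on the constraint, `⟨N, y⟩` is 0 for a coordinate row and `-1` for a row `-γ j`, which
  -- thus becomes `M - γ j`.
  have key : ((connectedSum α γ M o l).normals fun a => Sum.map id Sum.inr (i a)) =
      (cornered γ o' l₂).normals i * (1 + C * R) := by
    rw [Matrix.mul_add, Matrix.mul_one, ← Matrix.mul_assoc, ← Matrix.replicateCol_mulVec]
    ext a b
    rw [Matrix.add_apply, Matrix.mul_apply, Fintype.sum_unique, Matrix.replicateCol_apply,
      show R default b = 1 from rfl, normals_mulVec, dotProduct_smul, (h.active (i a)).2 ⟨a, rfl⟩]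
    rcases h' : i a with c | j
    · simp [normals, h', connectedSum, cornered]
    · simp [normals, h', connectedSum, cornered]
      ring
  rw [key, Matrix.det_mul, Matrix.det_one_add_replicateCol_mul_replicateRow, dotProduct_smul,
    one_dotProduct, smul_eq_mul]
  ring

namespace GluingBound

theorem one_le_mul_sum₁ (hb : GluingBound α γ A G M) {x : Fin n → ℝ}
    (hx : ∀ a, 0 ≤ x a) {j : κ₁} (hj : α j ⬝ᵥ x = 1) :
    1 ≤ A * ∑ b, x b := hj ▸ dotProduct_le_mul_sum (hb.le₁ j) hx

theorem one_le_mul_sum₂ (hb : GluingBound α γ A G M) {x : Fin n → ℝ}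
    (hx : ∀ a, 0 ≤ x a) {k : κ₂} (hk : γ k ⬝ᵥ x = 1) :
    1 ≤ G * ∑ b, x b := hk ▸ dotProduct_le_mul_sum (hb.le₂ k) hx

theorem cut_lt (hb : GluingBound α γ A G M) {x : Fin n → ℝ}
    (h : (cornered α o l₁).IsVertex x) (hx : x ≠ 0) (k : κ₂) :
    1 < M * ∑ b, x b - γ k ⬝ᵥ x := by
  have hx0 := (mem_cornered.1 h.1).1
  obtain ⟨j, hj⟩ := h.exists_active_inr hx
  have h1 := hb.one_le_mul_sum₁ hx0 hj
  have h2 := dotProduct_le_mul_sum (hb.le₂ k) hx0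
  have h3 : 0 < ∑ b, x b := pos_of_mul_pos_right (by linarith) hb.pos₁.le
  have h4 := mul_lt_mul_of_pos_right hb.lt h3
  linarith

theorem isCorner₁ (hb : GluingBound α γ A G M) {x : Fin n → ℝ} {i : Fin n → Fin n ⊕ κ₁}
    (h : (cornered α o l₁).IsCorner x i) (hx : x ≠ 0) :
    (connectedSum α γ M o l).IsCorner x fun a => Sum.map id Sum.inl (i a) where
  mem := by
    obtain ⟨h1, h2⟩ := mem_cornered.1 h.mem
    exact mem_connectedSum.2 ⟨h1, h2, fun k => (hb.cut_lt h.isVertex hx k).le⟩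
  active := by
    have hr : ∀ k, k ∈ Set.range i ↔
        Sum.map id Sum.inl k ∈ Set.range fun a => Sum.map id (Sum.inl (β := κ₂)) (i a) := by
      intro k
      have hinj : Function.Injective (Sum.map (id : Fin n → Fin n) (Sum.inl : κ₁ → κ₁ ⊕ κ₂)) :=
        Function.injective_id.sumMap Sum.inl_injective
      simp [hinj.eq_iff]
    rintro (a | j | k)
    · rw [connectedSum_active_inl, ← cornered_active_inl, h.active, hr]
      rfl
    · rw [connectedSum_active_outer, ← cornered_active_inr, h.active, hr]
      rfl
    · rw [connectedSum_active_cut]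
      refine iff_of_false (hb.cut_lt h.isVertex hx k).ne' ?_
      rintro ⟨a, ha⟩
      rcases h' : i a with b | j <;> simp [h'] at ha
  det_ne := by
    rw [normals₁]
    exact h.det_ne

theorem term₁ (hl₁ : ∀ k, l (Sum.map id Sum.inl k) = l₁ k) (i : Fin n → Fin n ⊕ κ₁) :
    (connectedSum α γ M o l).term (fun a => Sum.map id Sum.inl (i a)) =
      (cornered α o l₁).term i := by
  unfold term
  rw [normals₁ (o' := o) (l₁ := l₁)]
  simp [connectedSum, cornered, hl₁]

theorem one_lt_mul_sum₂ (hb : GluingBound α γ A G M) {y : Fin n → ℝ}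
    (h : (cornered γ o' l₂).IsVertex y) (hy : y ≠ 0) : 1 + A * ∑ b, y b < M * ∑ b, y b := by
  obtain ⟨k, hk⟩ := h.exists_active_inr hy
  have h1 := hb.one_le_mul_sum₂ (mem_cornered.1 h.1).1 hk
  have h3 : 0 < ∑ b, y b := pos_of_mul_pos_right (by linarith) hb.pos₂.le
  have h4 := mul_lt_mul_of_pos_right hb.lt h3
  linarith

theorem denom_pos (hb : GluingBound α γ A G M) {y : Fin n → ℝ}
    (h : (cornered γ o' l₂).IsVertex y) (hy : y ≠ 0) : 0 < M * ∑ b, y b - 1 := by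
  have h1 := hb.one_lt_mul_sum₂ h hy
  have h2 : 0 ≤ A * ∑ b, y b :=
    mul_nonneg hb.pos₁.le (Finset.sum_nonneg fun a _ => (mem_cornered.1 h.1).1 a)
  linarith

/-- With `D = M ∑ y - 1 > 0`, the `k`-th cut has slack `D⁻¹ (1 - γ k ⬝ᵥ y)` at `D⁻¹ y`, and
coordinates are scaled by `D⁻¹`; so the active constraints correspond to those at `y`. -/
theorem isCorner₂ (hb : GluingBound α γ A G M) {y : Fin n → ℝ} {i : Fin n → Fin n ⊕ κ₂}
    (h : (cornered γ o' l₂).IsCorner y i) (hy : y ≠ 0) :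
    (connectedSum α γ M o l).IsCorner ((M * ∑ b, y b - 1)⁻¹ • y)
      fun a => Sum.map id Sum.inr (i a) := by
  have hD := hb.denom_pos h.isVertex hy
  set D := M * ∑ b, y b - 1 with hDdef
  obtain ⟨h1, h2⟩ := mem_cornered.1 h.mem
  have hsum : ∑ b, (D⁻¹ • y) b = D⁻¹ * ∑ b, y b := by
    rw [Finset.mul_sum]
    rfl
  have hα : ∀ j, α j ⬝ᵥ (D⁻¹ • y) < 1 := fun j => by
    rw [dotProduct_smul, smul_eq_mul, inv_mul_lt_iff₀ hD, mul_one]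
    have := dotProduct_le_mul_sum (hb.le₁ j) h1
    have := hb.one_lt_mul_sum₂ h.isVertex hy
    linarith
  have hγ : ∀ k, M * ∑ b, (D⁻¹ • y) b - γ k ⬝ᵥ (D⁻¹ • y) - 1 =
      D⁻¹ * (1 - γ k ⬝ᵥ y) := fun k => by
    have : D⁻¹ * D = 1 := inv_mul_cancel₀ hD.ne'
    rw [hsum, dotProduct_smul, smul_eq_mul]
    rw [hDdef] at this ⊢
    linear_combination this
  refine ⟨mem_connectedSum.2 ⟨fun a => mul_nonneg (inv_nonneg.2 hD.le) (h1 a),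
    fun j => (hα j).le, fun k => ?_⟩, ?_, ?_⟩
  · rw [← sub_nonneg, hγ]
    exact mul_nonneg (inv_nonneg.2 hD.le) (sub_nonneg.2 (h2 k))
  · have hr : ∀ k, k ∈ Set.range i ↔
        Sum.map id Sum.inr k ∈ Set.range fun a => Sum.map id (Sum.inr (α := κ₁)) (i a) := by
      intro k
      have hinj : Function.Injective (Sum.map (id : Fin n → Fin n) (Sum.inr : κ₂ → κ₁ ⊕ κ₂)) :=
        Function.injective_id.sumMap Sum.inr_injective
      simp [hinj.eq_iff]
    rintro (a | j | k)
    · have h3 : (D⁻¹ • y) a = 0 ↔ y a = 0 := by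
        simp [hD.ne']
      rw [connectedSum_active_inl, h3, ← cornered_active_inl, h.active, hr]
      rfl
    · rw [connectedSum_active_outer]
      refine iff_of_false (hα j).ne ?_
      rintro ⟨a, ha⟩
      rcases h' : i a with b | j <;> simp [h'] at ha
    · rw [connectedSum_active_cut, ← sub_eq_zero, hγ, mul_eq_zero_iff_left (inv_ne_zero hD.ne'),
        sub_eq_zero, eq_comm, ← cornered_active_inr, h.active, hr]
      rfl
  · rw [det_normals₂ h]
    exact mul_ne_zero h.det_ne (by linarith)

/-- The projective map reverses the sign of the determinant, which compensates for the opposite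
orientations `-o` and `o`. -/
theorem term₂ (hb : GluingBound α γ A G M) {y : Fin n → ℝ} {i : Fin n → Fin n ⊕ κ₂}
    (h : (cornered γ (-o) l₂).IsCorner y i) (hy : y ≠ 0)
    (hl₂ : ∀ k, l (Sum.map id Sum.inr k) = l₂ k) :
    (connectedSum α γ M o l).term (fun a => Sum.map id Sum.inr (i a)) =
      (cornered γ (-o) l₂).term i := by
  have hD := hb.denom_pos h.isVertex hy
  unfold term
  rw [det_normals₂ h, sign_mul, sign_neg (a := 1 - M * ∑ b, y b) (by linarith)]
  simp [connectedSum, cornered, hl₂]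

/-- This makes the involution defined with positive denominator on the whole connected sum: a point
with `M ∑ x ≤ 1` would satisfy `γ k ⬝ᵥ x ≤ 0` for all `k` and span a ray in the second polytope,
unless it is zero. -/
theorem one_lt_mul_sum (hn : 0 < n) (hL₂ : (cornered γ o' l₂).IsQuasitoric) {x : Fin n → ℝ}
    (hx : x ∈ (connectedSum α γ M o l).carrier) : 1 < M * ∑ b, x b := by
  obtain ⟨h1, -, h3⟩ := mem_connectedSum.1 hx
  by_contra! hle
  have hx0 : x = 0 := eq_zero_of_isBounded_cornered hL₂.bounded h1 fun k => by
    linarith [h3 k]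
  subst hx0
  -- The origin violates every cut, so there are none; then the second polytope is a full orthant
  -- and contains the ray through the all-ones vector.
  have h4 : (1 : Fin n → ℝ) = 0 := eq_zero_of_isBounded_cornered hL₂.bounded
    (fun _ => zero_le_one) fun k => by
      have := h3 k
      simp at this
      linarith
  exact one_ne_zero (congrFun h4 ⟨0, hn⟩)

theorem isVertex_cases (hb : GluingBound α γ A G M) (hn : 0 < n)
    (hL₂ : (cornered γ o' l₂).IsQuasitoric) {x : Fin n → ℝ}
    (hx : (connectedSum α γ M o l).IsVertex x) :
    (x ≠ 0 ∧ (cornered α o l₁).IsVertex x) ∨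
      ∃ y, (y ≠ 0 ∧ (cornered γ o' l₂).IsVertex y) ∧ (M * ∑ b, y b - 1)⁻¹ • y = x := by
  have hD := one_lt_mul_sum hn hL₂ hx.1
  obtain ⟨h1, h2, h3⟩ := mem_connectedSum.1 hx.1
  have hx0 : x ≠ 0 := by
    rintro rfl
    simp at hD
    linarith
  by_cases hcut : ∃ k, M * ∑ b, x b - γ k ⬝ᵥ x = 1
  · right
    obtain ⟨k₀, hk₀⟩ := hcut
    set D := M * ∑ b, x b - 1 with hDdef
    have hD0 : 0 < D := sub_pos.2 hD
    have hDD : D⁻¹ * D = 1 := inv_mul_cancel₀ hD0.ne'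
    have hsum : ∑ b, (D⁻¹ • x) b = D⁻¹ * ∑ b, x b := by
      rw [Finset.mul_sum]
      rfl
    have hden : M * ∑ b, (D⁻¹ • x) b - 1 = D⁻¹ := by
      rw [hsum]
      rw [hDdef] at hDD ⊢
      linear_combination hDD
    have hγ : ∀ k, γ k ⬝ᵥ (D⁻¹ • x) ≤ 1 := fun k => by
      rw [dotProduct_smul, smul_eq_mul, inv_mul_le_iff₀ hD0, mul_one]
      linarith [h3 k]
    -- An active cut gives `(M - G) ∑ x ≤ 1`, an active outer constraint gives `1 ≤ A ∑ x`; together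
    -- they contradict `A + G < M`.
    have hα : ∀ j, α j ⬝ᵥ x ≠ 1 := fun j hj => by
      have h4 := hb.one_le_mul_sum₁ h1 hj
      have h5 := dotProduct_le_mul_sum (hb.le₂ k₀) h1
      have h6 : 0 < ∑ b, x b := pos_of_mul_pos_right (by linarith) hb.pos₁.le
      have h7 := mul_lt_mul_of_pos_right hb.lt h6
      linarith
    refine ⟨D⁻¹ • x, ⟨smul_ne_zero (inv_ne_zero hD0.ne') hx0,
      mem_cornered.2 ⟨fun a => mul_nonneg (inv_nonneg.2 hD0.le) (h1 a), hγ⟩, fun d hd => ?_⟩, ?_⟩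
    -- Up to the factor `D`, this vector is the image of `d` under the derivative of the involution
    -- at `D⁻¹ • x`. Taking coordinate sums afterwards gives `(∑ d) D = 0`, whence `d = 0`.
    · have hz : d - (M * ∑ b, d b) • x = 0 := by
        refine hx.2 _ ?_
        rintro (a | j | k) hk
        · rw [connectedSum_active_inl] at hk
          have h4 := hd (Sum.inl a) ((cornered_active_inl _ _).2 (by simp [hk]))
          rw [cornered_normal_inl] at h4
          change Pi.single a 1 ⬝ᵥ _ = (0 : ℝ)
          rw [single_one_dotProduct]
          simp [h4, hk]
        · exact absurd ((connectedSum_active_outer _ _).1 hk) (hα j)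
        · rw [connectedSum_active_cut] at hk
          have h4 := hd (Sum.inr k) ((cornered_active_inr _ _).2 (by
            rw [dotProduct_smul, smul_eq_mul, ← hDD, hDdef]
            congr 1
            linarith))
          rw [cornered_normal_inr] at h4
          rw [connectedSum_normal_cut, dotProduct_sub, dotProduct_smul, smul_eq_mul]
          simp only [Pi.sub_apply, Pi.smul_apply, smul_eq_mul, Finset.sum_sub_distrib,
            ← Finset.mul_sum]
          linear_combination h4 - (M * ∑ b, d b) * hk
      have hd' : d = (M * ∑ b, d b) • x := sub_eq_zero.1 hz
      have hs : ∑ b, d b = (M * ∑ b, d b) * ∑ b, x b := by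
        conv_lhs => rw [hd']
        simp [Finset.mul_sum]
      have hs' : (∑ b, d b) * D = 0 := by
        rw [hDdef]
        linear_combination -hs
      rw [hd', (mul_eq_zero.1 hs').resolve_right hD0.ne', mul_zero, zero_smul]
    · rw [hden, inv_inv, smul_smul, mul_inv_cancel₀ hD0.ne', one_smul]
  · left
    refine ⟨hx0, mem_cornered.2 ⟨h1, h2⟩, fun d hd => hx.2 d ?_⟩
    rintro (a | j | k) hk
    · exact hd (Sum.inl a) hk
    · exact hd (Sum.inr j) hk
    · exact absurd ⟨k, (connectedSum_active_cut _ _).1 hk⟩ hcut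

end GluingBound

theorem polynomial_cornered {κ : Type} [Finite κ] (α : κ → Fin n → ℝ) (o : ℤˣ)
    (l : Fin n ⊕ κ → J n) :
    (cornered α o l).polynomial = ((o : ℤ) • wedge fun a => l (Sum.inl a)) +
      ∑ᶠ x ∈ {x | x ≠ 0 ∧ (cornered α o l).IsVertex x}, (cornered α o l).monomial x := by
  have hins : {x | (cornered α o l).IsVertex x} =
      insert 0 {x | x ≠ 0 ∧ (cornered α o l).IsVertex x} := by
    ext x
    by_cases hx : x = 0
    · simp [hx, isCorner_cornered_zero.isVertex]
    · simp [hx]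
  rw [polynomial, hins, finsum_mem_insert _ (by simp)
    (finite_setOf_isVertex.subset fun x hx => hx.2),
    isCorner_cornered_zero.monomial_eq, term_cornered_inl]

/-- The origin monomials have equal labels and opposite signs, so discarding both corners leaves the
sum of the polynomials unchanged. The last clause keeps track of the surviving corners of the first
summand, as needed when that summand is a cube. -/
theorem exists_connectedSum [Finite κ₁] [Finite κ₂] (hn : 1 < n)
    (hL₁ : (cornered α o l₁).IsQuasitoric) (hL₂ : (cornered γ (-o) l₂).IsQuasitoric)
    (hl : ∀ a, l₁ (Sum.inl a) = l₂ (Sum.inl a)) :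
    ∃ L : LabelledArrangement n (Fin n ⊕ (κ₁ ⊕ κ₂)), L.IsQuasitoric ∧
      L.polynomial = (cornered α o l₁).polynomial + (cornered γ (-o) l₂).polynomial ∧
      ∀ x i, x ≠ 0 → (cornered α o l₁).IsCorner x i → ∃ i', L.IsCorner x i' ∧
        L.orientation = o ∧ L.normals i' = (cornered α o l₁).normals i ∧
        ∀ a, L.label (i' a) = l₁ (i a) := by
  obtain ⟨A, G, M, hb⟩ := exists_gluingBound α γ
  set l : Fin n ⊕ (κ₁ ⊕ κ₂) → J n := Sum.elim (fun a => l₁ (Sum.inl a))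
    (Sum.elim (fun j => l₁ (Sum.inr j)) fun k => l₂ (Sum.inr k)) with hldef
  have hl₁ : ∀ k, l (Sum.map id Sum.inl k) = l₁ k := by
    rintro (a | j) <;> rfl
  have hl₂ : ∀ k, l (Sum.map id Sum.inr k) = l₂ k := by
    rintro (a | j)
    · exact hl a
    · rfl
  have hn0 : 0 < n := by omega
  refine ⟨connectedSum α γ M o l, ⟨?_, ?_, ?_, ?_⟩, ?_, ?_⟩
  · refine hL₁.bounded.subset fun x hx => ?_
    obtain ⟨h1, h2, -⟩ := mem_connectedSum.1 hx
    exact mem_cornered.2 ⟨h1, h2⟩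
  · have hpos : 0 < A + (M - G) := by linarith [hb.pos₁, hb.lt]
    -- The reciprocal of the mean of `A < M - G`, so that `1 / (M - G) < s < 1 / A`: points with
    -- coordinate sum `s` lie strictly between the cuts and the outer facets.
    set s : ℝ := 2 / (A + (M - G)) with hs
    have hs0 : 0 < s := by positivity
    have hsA : A * s < 1 := by
      rw [hs, ← mul_div_assoc, div_lt_one hpos]
      linarith [hb.lt]
    have hsM : 1 < (M - G) * s := by
      rw [hs, ← mul_div_assoc, one_lt_div hpos]
      linarith [hb.lt]
    have hnR : (0 : ℝ) < n := by exact_mod_cast hn0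
    set x : Fin n → ℝ := fun _ => s / n with hx
    have hx0 : ∀ a, 0 < x a := fun a => by positivity
    have hsum : ∑ b, x b = s := by
      rw [hx]
      simp
      field_simp
    refine ⟨x, ?_⟩
    rintro (a | j | k)
    · change 0 < Pi.single a 1 ⬝ᵥ x
      rw [single_one_dotProduct]
      exact hx0 a
    · change -1 < -α j ⬝ᵥ x
      have := dotProduct_le_mul_sum (hb.le₁ j) fun b => (hx0 b).le
      rw [hsum] at this
      rw [neg_dotProduct]
      linarith
    · rw [connectedSum_normal_cut, hsum]
      have := dotProduct_le_mul_sum (hb.le₂ k) fun b => (hx0 b).le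
      rw [hsum] at this
      change 1 < _
      linarith
  · intro x hx
    rcases hb.isVertex_cases (l₁ := l₁) hn0 hL₂ hx with ⟨h0, h⟩ | ⟨y, ⟨h0, h⟩, rfl⟩
    · obtain ⟨i, hi, hu⟩ := hL₁.corner x h
      refine ⟨_, hb.isCorner₁ hi h0, ?_⟩
      simpa [labels, connectedSum, cornered, hl₁] using hu
    · obtain ⟨i, hi, hu⟩ := hL₂.corner y h
      refine ⟨_, hb.isCorner₂ hi h0, ?_⟩
      simpa [labels, connectedSum, cornered, hl₂] using hu
  · rintro (a | j | k)
    -- The origin is cut off, so the coordinate facet needs another vertex to stay in use.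
    · obtain ⟨x, hx, hxa, hx0⟩ := hL₁.exists_isVertex_ne_zero hn a
      obtain ⟨i, hi, -⟩ := hL₁.corner x hx
      exact ⟨x, (hb.isCorner₁ hi hx0).isVertex, (connectedSum_active_inl _ _).2 hxa⟩
    · obtain ⟨x, hx, hxj⟩ := hL₁.used (Sum.inr j)
      obtain ⟨i, hi, -⟩ := hL₁.corner x hx
      rw [cornered_active_inr] at hxj
      exact ⟨x, (hb.isCorner₁ hi (by rintro rfl; simp at hxj)).isVertex,
        (connectedSum_active_outer _ _).2 hxj⟩
    · obtain ⟨y, hy, hyk⟩ := hL₂.used (Sum.inr k)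
      obtain ⟨i, hi, -⟩ := hL₂.corner y hy
      have hy0 : y ≠ 0 := by
        rintro rfl
        rw [cornered_active_inr] at hyk
        simp at hyk
      have hc := hb.isCorner₂ (l := l) (o := o) hi hy0
      refine ⟨_, hc.isVertex, (hc.active _).2 ?_⟩
      obtain ⟨a, ha⟩ := (hi.active _).1 hyk
      exact ⟨a, by simp [ha]⟩
  · set φ : (Fin n → ℝ) → Fin n → ℝ := fun y => (M * ∑ b, y b - 1)⁻¹ • y with hφ
    set V₁ := {x | x ≠ 0 ∧ (cornered α o l₁).IsVertex x} with hV₁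
    set V₂ := {y | y ≠ 0 ∧ (cornered γ (-o) l₂).IsVertex y} with hV₂
    have hV : {x | (connectedSum α γ M o l).IsVertex x} = V₁ ∪ φ '' V₂ := by
      ext x
      refine ⟨hb.isVertex_cases (l₁ := l₁) hn0 hL₂, ?_⟩
      rintro (⟨h0, h⟩ | ⟨y, ⟨h0, h⟩, rfl⟩)
      · obtain ⟨i, hi, -⟩ := hL₁.corner x h
        exact (hb.isCorner₁ hi h0).isVertex
      · obtain ⟨i, hi, -⟩ := hL₂.corner y h
        exact (hb.isCorner₂ hi h0).isVertex
    have hdisj : Disjoint V₁ (φ '' V₂) := by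
      rw [Set.disjoint_left]
      rintro _ ⟨h0, h⟩ ⟨y, ⟨hy0, hy⟩, rfl⟩
      obtain ⟨i, hi, -⟩ := hL₂.corner y hy
      obtain ⟨k, hk⟩ := hy.exists_active_inr hy0
      obtain ⟨a, ha⟩ := (hi.active (Sum.inr k)).1 ((cornered_active_inr _ _).2 hk)
      have h1 := ((hb.isCorner₂ (l := l) (o := o) hi hy0).active (Sum.inr (Sum.inr k))).2
        ⟨a, by simp [ha]⟩
      exact (hb.cut_lt h h0 k).ne' ((connectedSum_active_cut _ _).1 h1)
    have hfin₁ : V₁.Finite := finite_setOf_isVertex.subset fun x hx => hx.2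
    have hfin₂ : V₂.Finite := finite_setOf_isVertex.subset fun x hx => hx.2
    have hinj : Set.InjOn φ V₂ := by
      rintro y ⟨hy0, hy⟩ z ⟨hz0, hz⟩ hyz
      have hDy := hb.denom_pos hy hy0
      have hDz := hb.denom_pos hz hz0
      have inv : ∀ w : Fin n → ℝ, 0 < M * ∑ b, w b - 1 →
          (M * ∑ b, φ w b - 1)⁻¹ • φ w = w := fun w hw => by
        have hsum : ∑ b, φ w b = (M * ∑ b, w b - 1)⁻¹ * ∑ b, w b := by
          rw [Finset.mul_sum]
          rfl
        have hden : M * ∑ b, φ w b - 1 = (M * ∑ b, w b - 1)⁻¹ := by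
          rw [hsum]
          linear_combination inv_mul_cancel₀ hw.ne'
        rw [hden, inv_inv, hφ]
        simp only
        rw [smul_smul, mul_inv_cancel₀ hw.ne', one_smul]
      rw [← inv y hDy, ← inv z hDz, hyz]
    rw [polynomial, hV, finsum_mem_union hdisj hfin₁ (hfin₂.image _), finsum_mem_image hinj,
      polynomial_cornered, polynomial_cornered]
    have h1 : ∑ᶠ x ∈ V₁, (connectedSum α γ M o l).monomial x =
        ∑ᶠ x ∈ V₁, (cornered α o l₁).monomial x := by
      refine finsum_mem_congr rfl fun x hx => ?_
      obtain ⟨i, hi, -⟩ := hL₁.corner x hx.2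
      rw [hi.monomial_eq, (hb.isCorner₁ hi hx.1).monomial_eq, GluingBound.term₁ hl₁]
    have h2 : ∑ᶠ y ∈ V₂, (connectedSum α γ M o l).monomial (φ y) =
        ∑ᶠ y ∈ V₂, (cornered γ (-o) l₂).monomial y := by
      refine finsum_mem_congr rfl fun y hy => ?_
      obtain ⟨i, hi, -⟩ := hL₂.corner y hy.2
      rw [hi.monomial_eq, (hb.isCorner₂ hi hy.1).monomial_eq, hb.term₂ hi hy.1 hl₂]
    rw [h1, h2]
    simp only [hl, Units.val_neg, neg_smul]
    abel
  · intro x i hx hi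
    exact ⟨_, hb.isCorner₁ hi hx, rfl, normals₁ i, fun a => hl₁ (i a)⟩

end connectedSum

end LabelledArrangement

/-! ### Cubes with vanishing polynomial -/

namespace LabelledArrangement

variable {n : ℕ}

section cube

/-- The unit cube, with labels `l a` on `x a = 0` and `m a` on `x a = 1`. -/
def cube (o : ℤˣ) (l m : Fin n → J n) : LabelledArrangement n (Fin n ⊕ Fin n) :=
  cornered (fun a => Pi.single a 1) o (Sum.elim l m)

/-- The vertices of the cube correspond to subsets of the coordinates. -/
def cubePoint (S : Finset (Fin n)) : Fin n → ℝ := fun a => if a ∈ S then 1 else 0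

/-- The facets at a vertex of the cube. -/
def cubeFacets (S : Finset (Fin n)) : Fin n → Fin n ⊕ Fin n :=
  fun a => if a ∈ S then Sum.inr a else Sum.inl a

variable {o : ℤˣ} {l m : Fin n → J n}

theorem det_normals_cubeFacets (S : Finset (Fin n)) :
    ((cube o l m).normals (cubeFacets S)).det = (-1) ^ S.card := by
  have : (cube o l m).normals (cubeFacets S) =
      Matrix.diagonal fun a => if a ∈ S then -1 else 1 := by
    ext a b
    by_cases ha : a ∈ S
    · by_cases hab : a = b
      · subst hab
        simp [normals, cubeFacets, cube, cornered, ha]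
      · simp [normals, cubeFacets, cube, cornered, ha, hab, Ne.symm hab]
    · by_cases hab : a = b
      · subst hab
        simp [normals, cubeFacets, cube, cornered, ha]
      · simp [normals, cubeFacets, cube, cornered, ha, hab, Ne.symm hab]
  rw [this, Matrix.det_diagonal, Finset.prod_ite]
  simp

theorem label_cubeFacets (S : Finset (Fin n)) (a : Fin n) :
    (cube o l m).label (cubeFacets S a) = if a ∈ S then m a else l a := by
  by_cases ha : a ∈ S <;> simp [cube, cornered, cubeFacets, ha]

theorem isCorner_cube (S : Finset (Fin n)) :
    (cube o l m).IsCorner (cubePoint S) (cubeFacets S) where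
  mem := by
    refine mem_cornered.2 ⟨fun a => ?_, fun a => ?_⟩
    · unfold cubePoint
      split_ifs <;> simp
    · rw [single_one_dotProduct]
      unfold cubePoint
      split_ifs <;> simp
  active := by
    rintro (a | a)
    · rw [cube, cornered_active_inl]
      constructor
      · intro h
        refine ⟨a, ?_⟩
        by_cases ha : a ∈ S
        · simp [cubePoint, ha] at h
        · simp [cubeFacets, ha]
      · rintro ⟨b, hb⟩
        by_cases hbS : b ∈ S
        · simp [cubeFacets, hbS] at hb
        · simp only [cubeFacets, hbS, if_false, Sum.inl.injEq] at hb
          subst hb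
          simp [cubePoint, hbS]
    · rw [cube, cornered_active_inr, single_one_dotProduct]
      constructor
      · intro h
        refine ⟨a, ?_⟩
        by_cases ha : a ∈ S
        · simp [cubeFacets, ha]
        · simp [cubePoint, ha] at h
      · rintro ⟨b, hb⟩
        by_cases hbS : b ∈ S
        · simp only [cubeFacets, hbS, if_true, Sum.inr.injEq] at hb
          subst hb
          simp [cubePoint, hbS]
        · simp [cubeFacets, hbS] at hb
  det_ne := by
    rw [det_normals_cubeFacets]
    exact pow_ne_zero _ (by norm_num)

/-- If some coordinate were neither 0 nor 1, the corresponding basis vector would be killed by all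
active normals. -/
theorem exists_eq_cubePoint {x : Fin n → ℝ} (hx : (cube o l m).IsVertex x) :
    ∃ S, cubePoint S = x := by
  have h01 : ∀ a, x a = 0 ∨ x a = 1 := by
    intro a
    by_contra! hne
    have h0 : (Pi.single a 1 : Fin n → ℝ) = 0 := by
      refine hx.2 _ ?_
      rintro (b | b) hb
      · rw [cube, cornered_active_inl] at hb
        rw [cube, cornered_normal_inl]
        exact Pi.single_eq_of_ne (by rintro rfl; exact hne.1 hb) _
      · rw [cube, cornered_active_inr, single_one_dotProduct] at hb
        rw [cube, cornered_normal_inr, single_one_dotProduct,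
          Pi.single_eq_of_ne (by rintro rfl; exact hne.2 hb), neg_zero]
    simpa using congrFun h0 a
  refine ⟨Finset.univ.filter fun a => x a = 1, funext fun a => ?_⟩
  rcases h01 a with h | h <;> simp [cubePoint, h]

theorem cubePoint_injective : Function.Injective (cubePoint (n := n)) := by
  intro S T h
  ext a
  have := congrFun h a
  by_cases hS : a ∈ S <;> by_cases hT : a ∈ T <;> simp [cubePoint, hS, hT] at this ⊢

theorem isQuasitoric_cube
    (h : ∀ S : Finset (Fin n), IsUnit ((cube o l m).labels (cubeFacets S)).det) :
    (cube o l m).IsQuasitoric where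
  bounded := by
    refine (Metric.isBounded_Icc (0 : Fin n → ℝ) 1).subset fun x hx => ?_
    obtain ⟨h1, h2⟩ := mem_cornered.1 hx
    refine ⟨h1, fun a => ?_⟩
    have := h2 a
    rwa [single_one_dotProduct] at this
  interior := by
    refine ⟨fun _ => 1 / 2, ?_⟩
    rintro (a | a)
    · rw [cube, cornered_normal_inl]
      change (0 : ℝ) < 1 / 2
      norm_num
    · rw [cube, cornered_normal_inr, single_one_dotProduct]
      change (-1 : ℝ) < -(1 / 2)
      norm_num
  corner x hx := by
    obtain ⟨S, rfl⟩ := exists_eq_cubePoint hx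
    exact ⟨_, isCorner_cube S, h S⟩
  used := by
    rintro (a | a)
    · refine ⟨_, (isCorner_cube ∅).isVertex, ?_⟩
      rw [cube, cornered_active_inl]
      simp [cubePoint]
    · refine ⟨_, (isCorner_cube Finset.univ).isVertex, ?_⟩
      rw [cube, cornered_active_inr, single_one_dotProduct]
      simp [cubePoint]

theorem term_cubeFacets (S : Finset (Fin n)) :
    (cube o l m).term (cubeFacets S) =
      ((o : ℤ) * (-1) ^ S.card) • wedge fun a => if a ∈ S then m a else l a := by
  unfold term
  rw [det_normals_cubeFacets]
  simp only [label_cubeFacets]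
  congr 2
  rcases Nat.even_or_odd S.card with h | h <;> simp [h.neg_one_pow, sign_neg]

/-- A cube with equal labels on a pair of opposite facets has vanishing polynomial. -/
theorem polynomial_cube_eq_zero {c : Fin n} (hc : l c = m c) : (cube o l m).polynomial = 0 := by
  have h1 : (cube o l m).polynomial =
      ∑ S : Finset (Fin n), (cube o l m).term (cubeFacets S) := by
    rw [← finsum_eq_sum_of_fintype, ← finsum_mem_univ, polynomial]
    refine (finsum_mem_eq_of_bijOn cubePoint ⟨fun S _ => (isCorner_cube S).isVertex,
      cubePoint_injective.injOn, fun x hx => ?_⟩ fun S _ => (isCorner_cube S).monomial_eq.symm).symm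
    obtain ⟨S, rfl⟩ := exists_eq_cubePoint hx
    exact ⟨S, Set.mem_univ _, rfl⟩
  have h2 : ∀ S : Finset (Fin n), c ∉ S →
      (cube o l m).term (cubeFacets S) + (cube o l m).term (cubeFacets (insert c S)) = 0 := by
    intro S hS
    have hw : (fun a => if a ∈ insert c S then m a else l a) =
        fun a => if a ∈ S then m a else l a := by
      funext a
      by_cases hac : a = c
      · subst hac
        simp [hS, hc]
      · simp [hac]
    rw [term_cubeFacets, term_cubeFacets, hw, Finset.card_insert_of_notMem hS, pow_succ,
      ← add_smul]
    simp
  rw [h1]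
  -- Toggling membership of `c` keeps the labels and flips the parity of the cardinality, hence the
  -- sign.
  refine Finset.sum_involution (fun S _ => if c ∈ S then S.erase c else insert c S) ?_ ?_
    (fun _ _ => Finset.mem_univ _) ?_
  · intro S _
    by_cases hS : c ∈ S
    · rw [if_pos hS, add_comm]
      conv_lhs => rw [← Finset.insert_erase hS, Finset.erase_insert (Finset.notMem_erase _ _)]
      exact h2 _ (Finset.notMem_erase _ _)
    · rw [if_neg hS]
      exact h2 S hS
  · intro S _ _ h
    by_cases hS : c ∈ S
    · rw [if_pos hS] at h
      exact Finset.notMem_erase c S (h.symm ▸ hS)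
    · rw [if_neg hS] at h
      exact hS (h ▸ Finset.mem_insert_self c S)
  · intro S _
    by_cases hS : c ∈ S <;> simp [hS, Finset.insert_erase]

end cube

/-! ### Replacing one label at a corner -/

/-- `h` is the polynomial of a quasitoric polytope with a vertex whose monomial
is `o • (l 0 ∧ ⋯ ∧ l (n - 1))`. -/
def HasCorner (h : FreeExteriorPower n (J n)) (o : ℤˣ) (l : Fin n → J n) : Prop :=
  ∃ (κ : Type) (_ : Finite κ) (α : κ → Fin n → ℝ) (m : κ → J n),
    (cornered α o (Sum.elim l m)).IsQuasitoric ∧ (cornered α o (Sum.elim l m)).polynomial = h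

theorem IsQuasitoric.hasCorner {ι : Type} [Finite ι] {L : LabelledArrangement n ι}
    (hL : L.IsQuasitoric) {x : Fin n → ℝ} {i : Fin n → ι} (hi : L.IsCorner x i) {o : ℤˣ}
    (ho : (o : ℤ) = L.orientation * (SignType.sign (L.normals i).det : ℤ)) :
    HasCorner L.polynomial o fun a => L.label (i a) := by
  obtain ⟨κ, hκ, α, o', l, ho', hl, ⟨E⟩⟩ := hi.exists_cornered
  obtain rfl : o' = o := Units.ext (ho'.trans ho.symm)
  have hl' : l = Sum.elim (fun a => L.label (i a)) fun j => l (Sum.inr j) := by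
    funext k
    rcases k with a | j
    · exact hl a
    · rfl
  rw [hl'] at E
  exact ⟨κ, hκ, α, _, E.isQuasitoric hL, E.polynomial_eq hL⟩

theorem HasCorner.isUnit_det {h : FreeExteriorPower n (J n)} {o : ℤˣ} {l : Fin n → J n}
    (H : HasCorner h o l) : IsUnit (Matrix.of fun a b => (l a).1 b).det := by
  obtain ⟨κ, hκ, α, m, hL, -⟩ := H
  exact hL.isUnit_labels isCorner_cornered_zero

theorem _root_.Quasitoric.IsQuasitoricPolynomial.exists_hasCorner {h : FreeExteriorPower n (J n)}
    (H : IsQuasitoricPolynomial h) : ∃ o l, HasCorner h o l := by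
  obtain ⟨X, rfl⟩ := H
  have hL := X.isQuasitoric_arrangement
  obtain ⟨z, hz⟩ := hL.interior
  obtain ⟨x, hx⟩ := hL.isCompact.extremePoints_nonempty ⟨z, fun k => (hz k).le⟩
  obtain ⟨i, hi, -⟩ := hL.corner x (isVertex_of_mem_extremePoints hx)
  obtain ⟨κ, hκ, α, o, l, ho, -, -⟩ := hi.exists_cornered
  rw [← X.polynomial_arrangement]
  exact ⟨o, _, hL.hasCorner hi ho⟩

/-- The connected sum with a cube changes one label at a vertex and its sign at will. -/
theorem HasCorner.update (hn : 1 < n) {h : FreeExteriorPower n (J n)} {o : ℤˣ}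
    {l : Fin n → J n} (H : HasCorner h o l) (j : Fin n) (w : J n)
    (hw : IsUnit (Matrix.of fun a b => (Function.update l j w a).1 b).det) (o' : ℤˣ) :
    HasCorner h o' (Function.update l j w) := by
  have hl := H.isUnit_det
  obtain ⟨κ, hκ, α, m, hL, hLh⟩ := H
  have : Nontrivial (Fin n) := Fin.nontrivial_iff_two_le.2 hn
  obtain ⟨c, hc⟩ := exists_ne j
  -- The two label families differ only at `j`, so each vertex of the cube carries one of these two
  -- unimodular families.
  have hmix : ∀ S : Finset (Fin n), (fun a => if a ∈ S then Function.update l j w a else l a) =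
      if j ∈ S then Function.update l j w else l := by
    intro S
    by_cases hS : j ∈ S
    · rw [if_pos hS]
      funext a
      by_cases ha : a ∈ S
      · rw [if_pos ha]
      · rw [if_neg ha, Function.update_of_ne (by rintro rfl; exact ha hS)]
    · rw [if_neg hS]
      funext a
      by_cases ha : a ∈ S
      · rw [if_pos ha, Function.update_of_ne (by rintro rfl; exact hS ha)]
      · rw [if_neg ha]
  have hC : (cube (-o) l (Function.update l j w)).IsQuasitoric := by
    refine isQuasitoric_cube fun S => ?_
    have : (cube (-o) l (Function.update l j w)).labels (cubeFacets S) =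
        Matrix.of fun a b => ((if j ∈ S then Function.update l j w else l) a).1 b := by
      ext a b
      rw [← hmix]
      simp only [labels, label_cubeFacets, Matrix.of_apply]
    rw [this]
    split_ifs
    · exact hw
    · exact hl
  rw [← neg_neg o] at hL hLh
  obtain ⟨L, hLq, hLp, hLc⟩ := exists_connectedSum hn hC hL fun a => rfl
  have hp0 : (cube (-o) l (Function.update l j w)).polynomial = 0 :=
    polynomial_cube_eq_zero (c := c) (by rw [Function.update_of_ne hc])
  have hpoly : L.polynomial = h := by
    rw [hLp, hLh, ← cube, hp0, zero_add]
  -- The sign at the cube vertex `S` is `-o * (-1) ^ S.card`. Containing `j` yields the new labels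
  -- and keeps the vertex away from the origin; adding `c` or not adjusts the parity.
  obtain ⟨S, hjS, hS⟩ : ∃ S : Finset (Fin n), j ∈ S ∧ (o' : ℤ) = -o * (-1) ^ S.card := by
    rcases Int.units_eq_one_or o with rfl | rfl <;> rcases Int.units_eq_one_or o' with rfl | rfl
    · exact ⟨{j}, by simp, by simp⟩
    · exact ⟨{j, c}, by simp, by simp [Finset.card_pair hc.symm]⟩
    · exact ⟨{j, c}, by simp, by simp [Finset.card_pair hc.symm]⟩
    · exact ⟨{j}, by simp, by simp⟩
  obtain ⟨i', hi', hio, hin, hil⟩ := hLc _ _ (fun h0 => by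
    have := congrFun h0 j
    simp [cubePoint, hjS] at this) (isCorner_cube S)
  have hlab : (fun a => L.label (i' a)) = Function.update l j w := by
    have := hmix S
    rw [if_pos hjS] at this
    rw [← this]
    funext a
    rw [hil, ← label_cubeFacets (o := o)]
    rfl
  rw [← hpoly, ← hlab]
  refine hLq.hasCorner hi' ?_
  rw [hio, hin, ← cube, det_normals_cubeFacets, hS]
  rcases Nat.even_or_odd S.card with h | h <;> simp [h.neg_one_pow, sign_neg]

end LabelledArrangement

/-! ### Unimodular matrices connected by single-row changes -/

section UnimodularRows

variable {n : ℕ}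

/-- Two unimodular matrices that differ in at most one row. -/
def RowStep (A B : Matrix (Fin n) (Fin n) ℤ) : Prop :=
  IsUnit A.det ∧ IsUnit B.det ∧ ∃ j w, B = A.updateRow j w

theorem RowStep.symm {A B : Matrix (Fin n) (Fin n) ℤ} (h : RowStep A B) : RowStep B A := by
  obtain ⟨hA, hB, j, w, rfl⟩ := h
  exact ⟨hB, hA, j, A j, by rw [Matrix.updateRow_idem, Matrix.updateRow_eq_self]⟩

/-- A unimodular matrix whose first `k` columns are those of the identity. -/
def IsReduced (k : ℕ) (A : Matrix (Fin n) (Fin n) ℤ) : Prop :=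
  IsUnit A.det ∧ ∀ i j : Fin n, j.val < k → A i j = (1 : Matrix (Fin n) (Fin n) ℤ) i j

variable {k : ℕ} {A : Matrix (Fin n) (Fin n) ℤ}

theorem IsReduced.apply_eq_zero (h : IsReduced k A) {i j : Fin n} (hi : k ≤ i.val)
    (hj : j.val < k) : A i j = 0 := by
  rw [h.2 i j hj, Matrix.one_apply_ne]
  rintro rfl
  omega

/-- Adding a multiple of a lower row. -/
theorem IsReduced.add (h : IsReduced k A) {p q : Fin n} (hpq : p ≠ q) (hq : k ≤ q.val) (t : ℤ) :
    IsReduced k (A.updateRow p (A p + t • A q)) ∧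
      RowStep A (A.updateRow p (A p + t • A q)) := by
  have hu : IsUnit (A.updateRow p (A p + t • A q)).det := by
    rw [Matrix.det_updateRow_add_smul_self _ hpq]
    exact h.1
  refine ⟨⟨hu, fun i j hj => ?_⟩, h.1, hu, p, _, rfl⟩
  by_cases hi : i = p
  · subst hi
    rw [Matrix.updateRow_self, Pi.add_apply, Pi.smul_apply, h.apply_eq_zero hq hj, smul_zero,
      add_zero, h.2 i j hj]
  · rw [Matrix.updateRow_ne hi, h.2 i j hj]

theorem IsReduced.neg (h : IsReduced k A) {p : Fin n} (hp : k ≤ p.val) :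
    IsReduced k (A.updateRow p (-A p)) ∧ RowStep A (A.updateRow p (-A p)) := by
  have hu : IsUnit (A.updateRow p (-A p)).det := by
    rw [← neg_one_smul ℤ, Matrix.det_updateRow_smul, Matrix.updateRow_eq_self,
      neg_one_mul, IsUnit.neg_iff]
    exact h.1
  refine ⟨⟨hu, fun i j hj => ?_⟩, h.1, hu, p, _, rfl⟩
  by_cases hi : i = p
  · subst hi
    rw [Matrix.updateRow_self, Pi.neg_apply, h.apply_eq_zero hp hj, neg_zero, ← h.2 i j hj,
      h.apply_eq_zero hp hj]
  · rw [Matrix.updateRow_ne hi, h.2 i j hj]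

/-- Row `c` of `A⁻¹` writes 1 as an integral combination of the entries of column `c`. Its first `k`
coefficients vanish because the first `k` columns of `A` are those of the identity, so only rows
from `k` on contribute. -/
theorem IsReduced.exists_dvd_one (h : IsReduced k A) {c : Fin n} (hc : c.val = k) :
    (∃ p : Fin n, k ≤ p.val ∧ A p c ≠ 0) ∧
      ∀ p : Fin n, (∀ i : Fin n, k ≤ i.val → A i c ≠ 0 → i = p) → IsUnit (A p c) := by
  set u : Fin n → ℤ := A⁻¹ c with hu
  have hmul : ∀ j, ∑ i, u i * A i j = (1 : Matrix (Fin n) (Fin n) ℤ) c j := fun j => by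
    rw [← Matrix.nonsing_inv_mul _ h.1, Matrix.mul_apply]
  have hu0 : ∀ i : Fin n, i.val < k → u i = 0 := by
    intro i hi
    have h1 := hmul i
    rw [Finset.sum_eq_single i (fun b _ hb => by rw [h.2 b i hi, Matrix.one_apply_ne hb, mul_zero])
      (by simp), h.2 i i hi, Matrix.one_apply_eq, mul_one, Matrix.one_apply_ne] at h1
    · exact h1
    · rintro rfl
      omega
  have h1 := hmul c
  rw [Matrix.one_apply_eq] at h1
  constructor
  · by_contra! hne
    rw [Finset.sum_eq_zero] at h1
    · exact zero_ne_one h1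
    · intro i _
      by_cases hi : i.val < k
      · rw [hu0 i hi, zero_mul]
      · rw [hne i (by omega), mul_zero]
  · intro p hp
    rw [Finset.sum_eq_single p _ (by simp)] at h1
    · exact IsUnit.of_mul_eq_one _ ((mul_comm _ _).trans h1)
    · intro i _ hip
      by_cases hi : i.val < k
      · rw [hu0 i hi, zero_mul]
      · rw [not_ne_iff.1 fun h' => hip (hp i (by omega) h'), mul_zero]

/-- One step of the Euclidean algorithm. -/
theorem exists_natAbs_add_mul_lt {x y : ℤ} (hy : y ≠ 0) (hxy : y.natAbs ≤ x.natAbs) :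
    ∃ t, (x + t * y).natAbs < x.natAbs := by
  rcases le_total 0 x with hx | hx <;> rcases lt_or_gt_of_ne hy with h | h
  · exact ⟨1, by omega⟩
  · exact ⟨-1, by omega⟩
  · exact ⟨-1, by omega⟩
  · exact ⟨1, by omega⟩

/-- Euclidean algorithm on column `c`, by induction on the sum of absolute values from row `k` down.
It stops with a single nonzero entry there, which is a unit. -/
theorem IsReduced.exists_diagonal_one {c : Fin n} (hc : c.val = k) (m : ℕ) :
    ∀ {A : Matrix (Fin n) (Fin n) ℤ}, IsReduced k A →
      (∑ i ∈ Finset.univ.filter fun i : Fin n => k ≤ i.val, (A i c).natAbs) = m →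
      ∃ B, Relation.ReflTransGen RowStep A B ∧ IsReduced k B ∧ B c c = 1 := by
  induction m using Nat.strong_induction_on with
  | _ m ih =>
    intro A h hm
    by_cases hex : ∃ p q : Fin n, k ≤ p.val ∧ k ≤ q.val ∧ p ≠ q ∧ A q c ≠ 0 ∧
        (A q c).natAbs ≤ (A p c).natAbs
    · obtain ⟨p, q, hp, hq, hpq, hq0, hle⟩ := hex
      obtain ⟨t, ht⟩ := exists_natAbs_add_mul_lt hq0 hle
      obtain ⟨h1, h2⟩ := h.add hpq hq t
      obtain ⟨B, hB, hB'⟩ := ih _ (by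
        rw [← hm]
        refine Finset.sum_lt_sum (fun i _ => ?_) ⟨p, by simpa using hp, ?_⟩
        · by_cases hi : i = p
          · subst hi
            rw [Matrix.updateRow_self]
            exact ht.le
          · rw [Matrix.updateRow_ne hi]
        · rw [Matrix.updateRow_self]
          exact ht) h1 rfl
      exact ⟨B, .head h2 hB, hB'⟩
    · obtain ⟨⟨p, hp, hp0⟩, hunit⟩ := h.exists_dvd_one hc
      have huniq : ∀ i : Fin n, k ≤ i.val → A i c ≠ 0 → i = p := by
        intro i hi hi0
        by_contra hip
        rcases le_total (A i c).natAbs (A p c).natAbs with hle | hle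
        · exact hex ⟨p, i, hp, hi, Ne.symm hip, hi0, hle⟩
        · exact hex ⟨i, p, hi, hp, hip, hp0, hle⟩
      have hpu := Int.isUnit_iff.1 (hunit p huniq)
      by_cases hpc : p = c
      · subst hpc
        rcases hpu with h1 | h1
        · exact ⟨A, .refl, h, h1⟩
        · obtain ⟨h2, h3⟩ := h.neg hp
          exact ⟨_, .single h3, h2, by simp [h1]⟩
      -- Row `c` has entry 0 in column `c`; adding `A p c = ±1` times row `p` turns it into `(±1)² =
      -- 1`.
      · obtain ⟨h2, h3⟩ := h.add (Ne.symm hpc) hp (A p c)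
        have hc0 : A c c = 0 := not_ne_iff.1 fun h' => hpc (huniq c hc.ge h').symm
        refine ⟨_, .single h3, h2, ?_⟩
        rcases hpu with h1 | h1 <;> simp [h1, hc0]

theorem IsReduced.exists_clear {c : Fin n} (hc : c.val = k) (h : IsReduced k A)
    (h1 : A c c = 1) (S : Finset (Fin n)) (hS : c ∉ S) :
    ∃ B, Relation.ReflTransGen RowStep A B ∧ IsReduced k B ∧ B c c = 1 ∧
      ∀ i ∈ S, B i c = 0 := by
  induction S using Finset.induction_on with
  | empty => exact ⟨A, .refl, h, h1, by simp⟩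
  | insert p S hp ih =>
    obtain ⟨hcp, hcS⟩ := not_or.1 (fun h' => hS (Finset.mem_insert.2 h'))
    obtain ⟨B, hAB, hB, hBc, hBS⟩ := ih hcS
    obtain ⟨h2, h3⟩ := hB.add (p := p) (Ne.symm hcp) hc.ge (-B p c)
    refine ⟨_, hAB.tail h3, h2, ?_, fun i hi => ?_⟩
    · rw [Matrix.updateRow_ne hcp, hBc]
    · by_cases hip : i = p
      · subst hip
        simp [hBc]
      · rw [Matrix.updateRow_ne hip]
        exact hBS i ((Finset.mem_insert.1 hi).resolve_left hip)

theorem exists_isReduced (hA : IsUnit A.det) (hk : k ≤ n) :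
    ∃ B, Relation.ReflTransGen RowStep A B ∧ IsReduced k B := by
  induction k with
  | zero => exact ⟨A, .refl, hA, fun i j hj => absurd hj (Nat.not_lt_zero _)⟩
  | succ k ih =>
    obtain ⟨B, hAB, hB⟩ := ih (by omega)
    let c : Fin n := ⟨k, hk⟩
    obtain ⟨C, hBC, hC, hCc⟩ := IsReduced.exists_diagonal_one (c := c) rfl _ hB rfl
    obtain ⟨D, hCD, hD, hDc, hD0⟩ := hC.exists_clear (c := c) rfl hCc (Finset.univ.erase c)
      (Finset.notMem_erase _ _)
    refine ⟨D, (hAB.trans hBC).trans hCD, hD.1, fun i j hj => ?_⟩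
    rcases Nat.lt_succ_iff_lt_or_eq.1 hj with hj | hj
    · exact hD.2 i j hj
    · obtain rfl : j = c := Fin.ext hj
      by_cases hi : i = c
      · rw [hi, hDc, Matrix.one_apply_eq]
      · rw [hD0 i (by simpa using hi), Matrix.one_apply_ne hi]

theorem reflTransGen_rowStep_one (hA : IsUnit A.det) : Relation.ReflTransGen RowStep A 1 := by
  obtain ⟨B, hAB, hB⟩ := exists_isReduced hA le_rfl
  obtain rfl : B = 1 := by
    ext i j
    exact hB.2 i j j.2
  exact hAB

/-- Any two unimodular integral matrices are connected by changes of single rows. -/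
theorem reflTransGen_rowStep {B : Matrix (Fin n) (Fin n) ℤ} (hA : IsUnit A.det)
    (hB : IsUnit B.det) : Relation.ReflTransGen RowStep A B := by
  have hsymm : Std.Symm (RowStep (n := n)) := ⟨fun _ _ h => h.symm⟩
  exact (reflTransGen_rowStep_one hA).trans
    (Relation.ReflTransGen.stdSymm.symm _ _ (reflTransGen_rowStep_one hB))

end UnimodularRows

/-! ### Prescribing a corner, and the sum of two polynomials -/

namespace LabelledArrangement

variable {n : ℕ}

/-- A polytope with a vertex can be given a vertex with any unimodular labels and any sign. -/
theorem HasCorner.change (hn : 1 < n) {h : FreeExteriorPower n (J n)} {o : ℤˣ} {l : Fin n → J n}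
    (H : HasCorner h o l) {l' : Fin n → J n}
    (hl' : IsUnit (Matrix.of fun a b => (l' a).1 b).det) (o' : ℤˣ) : HasCorner h o' l' := by
  have key : ∀ B, Relation.ReflTransGen RowStep (Matrix.of fun a b => (l a).1 b) B →
      ∃ m : Fin n → J n, (Matrix.of fun a b => (m a).1 b) = B ∧ HasCorner h o m := by
    intro B hB
    induction hB with
    | refl => exact ⟨l, rfl, H⟩
    | tail _ hstep ih =>
      obtain ⟨m, rfl, hm⟩ := ih
      obtain ⟨-, hu, j, w, rfl⟩ := hstep
      -- Unimodularity forces the new row to be nonzero, hence an element of `J n`.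
      have hw : w ≠ 0 := by
        rintro rfl
        rw [Matrix.det_eq_zero_of_row_eq_zero j (by simp)] at hu
        exact not_isUnit_zero hu
      have heq : (Matrix.of fun a b => (Function.update m j ⟨w, hw⟩ a).1 b) =
          (Matrix.of fun a b => (m a).1 b).updateRow j w := by
        ext a b
        by_cases ha : a = j
        · subst ha
          simp
        · simp [ha]
      exact ⟨_, heq, hm.update hn j ⟨w, hw⟩ (heq ▸ hu) o⟩
  obtain ⟨m, hm, H'⟩ := key _ (reflTransGen_rowStep H.isUnit_det hl')
  obtain rfl : m = l' := funext fun a => Subtype.ext (congrFun hm a)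
  -- Replacing a label by itself leaves only the change of sign.
  have := H'.update hn ⟨0, by omega⟩ (m ⟨0, by omega⟩) (by simpa using hl') o'
  rwa [Function.update_eq_self] at this

end LabelledArrangement

end Quasitoric

end

open Quasitoric LabelledArrangement in
theorem mainTheorem6 (n : ℕ) (hn : 1 < n)
    (h₁ h₂ : Quasitoric.FreeExteriorPower n (Quasitoric.J n))
    (H₁ : Quasitoric.IsQuasitoricPolynomial h₁) (H₂ : Quasitoric.IsQuasitoricPolynomial h₂) :
    Quasitoric.IsQuasitoricPolynomial (h₁ + h₂) := by
  obtain ⟨o₁, l₁, C₁⟩ := H₁.exists_hasCorner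
  obtain ⟨o₂, l₂, C₂⟩ := H₂.exists_hasCorner
  -- The first polytope receives a corner with the labels of the chosen corner of the second and the
  -- opposite sign. Below, `o₂` is rewritten as `-(-o₂)` to fit `exists_connectedSum`.
  obtain ⟨κ₁, _, α, m₁, hL₁, rfl⟩ := C₁.change hn C₂.isUnit_det (-o₂)
  obtain ⟨κ₂, _, γ, m₂, hL₂, rfl⟩ := (neg_neg o₂).symm ▸ C₂
  obtain ⟨L, hL, hp, -⟩ := exists_connectedSum hn hL₁ hL₂ fun _ => rfl
  rw [← hp]
  exact hL.isQuasitoricPolynomial
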